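/- Notation. Let $\Lambda=\mathbb Z[\mathbb Z]=\mathbb Z[t,t^{-1}]$ with the involution $\overline{t}=t^{-1}$, let $\mathbb Q(\mathbb Z)$ be its field of fractions, and let $S=\{p\in\Lambda\mid p(1)=\pm1\}$. A $\Lambda$-module $A$ is torsion with respect to $S$ if $pA=0$ for some $p\in S$, and a chain complex of $\Lambda$-modules is $S$-acyclic if each of its homology modules is torsion with respect to $S$. For a $\Lambda$-module $A$ write $FA=A/T_{\mathbb Z}A$ for the quotient by the $\mathbb Z$-torsion submodule. For a chain complex $E$ of left $\Lambda$-modules, $E^r=\operatorname{Hom}_\Lambda(E_r,\Lambda)$ is a left $\Lambda$-module by $(a\cdot x)(w)=x(w)\overline a$, and $H^r(E;\Lambda)$ is the cohomology of $(E^*,d^*)$. The dual complex $E^{n-*}$ has differential $(-1)^r d^*\colon E^{n-r}\to E^{n-r+1}$. For a chain map $f\colon C\to D$, the complex $\operatorname{cone}(f)$ has $\operatorname{cone}(f)_r=D_r\oplus C_{r-1}$ with differential $(x,y)\mapsto(dx+(-1)^{r-1}f(y),dy)$, and $H^r(D,C;\Lambda)=H^r(\operatorname{cone}(f);\Lambda)$.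 Let $m\ge 0$ and let $f\colon C\to D$ be a chain map of chain complexes of finitely generated projective $\Lambda$-modules, with $C_r=0$ unless $0\le r\le m$ and $D_r=0$ unless $0\le r\le m+1$. An $(m+1)$-dimensional symmetric structure on $f$ is represented by a collection $(\delta\phi,\phi)$ of homomorphisms $\phi_s\colon C^{m-r+s}\to C_r$, $\delta\phi_s\colon D^{m+1-r+s}\to D_r$ ($r\in\mathbb Z$, $s\ge0$) such that, with $\phi_{-1}=0$, $\delta\phi_{-1}=0$ and $T\psi=(-1)^{pq}\psi^*$ for $\psi\in\operatorname{Hom}_\Lambda(C^p,C_q)$ or $\operatorname{Hom}_\Lambda(D^p,D_q)$, $$d\phi_s+(-1)^r\phi_s d^*+(-1)^{m+s-1}\bigl(\phi_{s-1}+(-1)^sT\phi_{s-1}\bigr)=0\colon C^{m-r+s-1}\to C_r,$$ $$d\,\delta\phi_s+(-1)^r\delta\phi_s d^*+(-1)^{m+s}\bigl(\delta\phi_{s-1}+(-1)^sT\delta\phi_{s-1}\bigr)+(-1)^mf\phi_sf^*=0\colon D^{m-r+s}\to D_r.$$ The pair $(f\colon C\to D,(\delta\phi,\phi))$ is Poincaré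 if the chain map $\Phi=(\delta\phi_0\;\;f\phi_0)\colon\operatorname{cone}(f)^{m+1-r}=D^{m+1-r}\oplus C^{m-r}\to D_r$ is a chain homotopy equivalence. Statement. Suppose that $C$ and $D$ are $S$-acyclic and that $(f\colon C\to D,(\delta\phi,\phi))$ is an $(m+1)$-dimensional symmetric Poincaré pair. Then for $1<i\le m$ there is a nonsingular pairing (the Blanchfield pairing) $$Bl\colon FH^i(D;\Lambda)\times FH^{m-i+2}(D,C;\Lambda)\to\mathbb Q(\mathbb Z)/\Lambda .$$ That is, $Bl$ is additive in each variable, $Bl(a\cdot x,b\cdot y)=\overline a\,b\,Bl(x,y)$ for all $a,b\in\Lambda$, and both adjoints, from $FH^i(D;\Lambda)$ to the $\Lambda$-linear maps $FH^{m-i+2}(D,C;\Lambda)\to\mathbb Q(\mathbb Z)/\Lambda$ and from $FH^{m-i+2}(D,C;\Lambda)$ to the conjugate-linear maps $FH^i(D;\Lambda)\to\mathbb Q(\mathbb Z)/\Lambda$, are bijective. Moreover $Bl$ is given by $$Bl([x],[y])=\frac{z(\Phi(y))}{p}\bmod\Lambda$$ for all cocycles $x\in D^i$ and $y\in\operatorname{cone}(f)^{m-i+2}$,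 all $0\ne p\in\Lambda$ and all $z\in D^{i-1}$ with $z(dw)=p\,x(w)$ for every $w\in D_i$. -/

import Mathlib

open CategoryTheory

universe u

namespace Blanchfield

/-! ### The group ring of the infinite cyclic group -/

/-- The group ring `ℤ[ℤ] = ℤ[t, t⁻¹]`. -/
abbrev GroupRing : Type := LaurentPolynomial ℤ

/-- The involution of `ℤ[ℤ]`, the linear extension of `t ↦ t⁻¹`. -/
noncomputable def conj : GroupRing →+* GroupRing :=
  (LaurentPolynomial.invert (R := ℤ)).toAlgHom.toRingHom

lemma conj_conj (a : GroupRing) : conj (conj a) = a :=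
  LaurentPolynomial.involutive_invert (R := ℤ) a

/-- Evaluation at `t = 1`. -/
noncomputable def evalOne : GroupRing →+* ℤ :=
  LaurentPolynomial.eval₂ (RingHom.id ℤ) 1

/-- The set `S` of Alexander polynomials: those `p` with `p(1) = ±1`. -/
def alexanderPolynomials : Set GroupRing :=
  {p | evalOne p = 1 ∨ evalOne p = -1}

/-- The field of fractions `ℚ(ℤ)` of `ℤ[ℤ]`. -/
abbrev FracField : Type := FractionRing GroupRing

/-- The `ℤ[ℤ]`-module `ℚ(ℤ)/ℤ[ℤ]`. -/
abbrev FracMod : Type :=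
  FracField ⧸ LinearMap.range (Algebra.linearMap GroupRing FracField)

/-- `A` is torsion with respect to `S`: some `p ∈ S` has `p A = 0`. -/
def IsSTorsion (A : Type u) [AddCommGroup A] [Module GroupRing A] : Prop :=
  ∃ p ∈ alexanderPolynomials, ∀ x : A, p • x = 0

/-- The `ℤ`-torsion submodule `T_ℤ A` of a `ℤ[ℤ]`-module `A`. -/
noncomputable abbrev intTorsion (A : Type u) [AddCommGroup A] [Module GroupRing A] :
    Submodule GroupRing A :=
  Submodule.torsion' GroupRing A (nonZeroDivisors ℤ)

/-- The `ℤ`-torsion free quotient `F A = A / T_ℤ A`. -/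
abbrev FreeQuot (A : Type u) [AddCommGroup A] [Module GroupRing A] : Type u :=
  A ⧸ intTorsion A

/-! ### Duals of left modules -/

/-- The dual `Hom(M, ℤ[ℤ])` of a left `ℤ[ℤ]`-module `M`, which is a left module through the
involution: `(a • x) w = x w * conj a`. -/
def ConjDual (M : Type u) [AddCommGroup M] [Module GroupRing M] : Type u :=
  Module.Dual GroupRing M

namespace ConjDual

variable {M N P : Type u} [AddCommGroup M] [Module GroupRing M] [AddCommGroup N]
  [Module GroupRing N] [AddCommGroup P] [Module GroupRing P]

noncomputable instance : AddCommGroup (ConjDual M) :=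
  inferInstanceAs (AddCommGroup (Module.Dual GroupRing M))

noncomputable instance : Module GroupRing (ConjDual M) :=
  Module.compHom (Module.Dual GroupRing M) conj

/-- Elements of the dual are functionals. -/
instance : FunLike (ConjDual M) M GroupRing :=
  inferInstanceAs (FunLike (Module.Dual GroupRing M) M GroupRing)

instance : LinearMapClass (ConjDual M) GroupRing M GroupRing :=
  inferInstanceAs (LinearMapClass (Module.Dual GroupRing M) GroupRing M GroupRing)

@[ext]
lemma ext {x y : ConjDual M} (h : ∀ w, x w = y w) : x = y := DFunLike.ext x y h

@[simp]
lemma add_apply (x y : ConjDual M) (w : M) : (x + y) w = x w + y w := rfl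

@[simp]
lemma zero_apply (w : M) : (0 : ConjDual M) w = 0 := rfl

@[simp]
lemma smul_apply (a : GroupRing) (x : ConjDual M) (w : M) : (a • x) w = conj a * x w := rfl

/-- The functional underlying an element of the dual. -/
def toDual (x : ConjDual M) : Module.Dual GroupRing M := x

/-- A functional, viewed as an element of the dual. -/
def ofDual (x : Module.Dual GroupRing M) : ConjDual M := x

@[simp]
lemma toDual_apply (x : ConjDual M) (w : M) : x.toDual w = x w := rfl

@[simp]
lemma ofDual_apply (x : Module.Dual GroupRing M) (w : M) : ofDual x w = x w := rfl

/-- The dual `x ↦ x ∘ g` of a linear map `g`. -/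
noncomputable def map (g : M →ₗ[GroupRing] N) : ConjDual N →ₗ[GroupRing] ConjDual M where
  toFun x := ofDual (x.toDual.comp g)
  map_add' _ _ := rfl
  map_smul' _ _ := rfl

@[simp]
lemma map_apply (g : M →ₗ[GroupRing] N) (x : ConjDual N) (w : M) : map g x w = x (g w) := rfl

/-- For `ψ : M* → N` and `y ∈ N*` the functional `x ↦ conj (y (ψ x))` on `M*`; it is linear for
the pointwise module structure on `M*`. -/
noncomputable def transposeAux (ψ : ConjDual M →ₗ[GroupRing] N) (y : ConjDual N) :
    Module.Dual GroupRing (Module.Dual GroupRing M) where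
  toFun x := conj (y (ψ (ofDual x)))
  map_add' x x' := by
    have h : ofDual (x + x') = ofDual x + ofDual x' := rfl
    rw [h, map_add, map_add, map_add]
  map_smul' a x := by
    have h : ofDual (a • x) = conj a • ofDual x := by
      ext w
      rw [smul_apply, conj_conj]
      rfl
    rw [h, map_smul, map_smul, smul_eq_mul, map_mul, conj_conj]
    rfl

/-- The dual `ψ* : N* → M** = M` of a linear map `ψ : M* → N`, for a reflexive module `M`. -/
noncomputable def transpose [Module.IsReflexive GroupRing M] (ψ : ConjDual M →ₗ[GroupRing] N) :
    ConjDual N →ₗ[GroupRing] M where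
  toFun y := (Module.evalEquiv GroupRing M).symm (transposeAux ψ y)
  map_add' y y' := by
    rw [← map_add]
    congr 1
    refine LinearMap.ext fun x => ?_
    exact map_add conj (y (ψ x)) (y' (ψ x))
  map_smul' a y := by
    rw [RingHom.id_apply, ← map_smul]
    congr 1
    refine LinearMap.ext fun x => ?_
    change conj (conj a * y (ψ x)) = a * conj (y (ψ x))
    rw [map_mul, conj_conj]

/-- The characteristic property of `ψ*`: `x (ψ* y) = conj (y (ψ x))`. -/
lemma apply_transpose [Module.IsReflexive GroupRing M] (ψ : ConjDual M →ₗ[GroupRing] N)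
    (x : ConjDual M) (y : ConjDual N) : x (transpose ψ y) = conj (y (ψ x)) := by
  change x.toDual ((Module.evalEquiv GroupRing M).symm (transposeAux ψ y)) = _
  rw [Module.apply_evalEquiv_symm_apply]
  rfl

end ConjDual

/-! ### Chain complexes, their cohomology and mapping cones -/

/-- Chain complexes of (left) `ℤ[ℤ]`-modules. -/
abbrev Cplx : Type (u + 1) := ChainComplex (ModuleCat.{u} GroupRing) ℤ

/-- `E_r = 0` outside the range `0 ≤ r ≤ n`. -/
def IsConcentrated (E : Cplx.{u}) (n : ℕ) : Prop :=
  ∀ r : ℤ, ¬ (0 ≤ r ∧ r ≤ n) → Subsingleton (E.X r)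

/-- A complex is `S`-acyclic if its homology is torsion with respect to `S`. -/
def IsSAcyclic (E : Cplx.{u}) : Prop :=
  ∀ r : ℤ, IsSTorsion (E.homology r)

/-- The coboundary map `d* : E^j → E^i`, of interest for `i = j + 1`, where `E^r = (E_r)*`. -/
noncomputable abbrev codiff (E : Cplx.{u}) (j i : ℤ) :
    ConjDual (E.X j) →ₗ[GroupRing] ConjDual (E.X i) :=
  ConjDual.map (E.d i j).hom

/-- The module of `k`-cocycles of `E`. -/
noncomputable abbrev cocycles (E : Cplx.{u}) (k : ℤ) :
    Submodule GroupRing (ConjDual (E.X k)) :=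
  LinearMap.ker (codiff E k (k + 1))

/-- The module of `k`-coboundaries of `E`, as a submodule of the cocycles. -/
noncomputable abbrev coboundaries (E : Cplx.{u}) (k : ℤ) :
    Submodule GroupRing (cocycles E k) :=
  (LinearMap.range (codiff E (k - 1) k)).submoduleOf (cocycles E k)

/-- The cohomology `H^k(E; ℤ[ℤ])`. -/
abbrev Cohomology (E : Cplx.{u}) (k : ℤ) : Type u :=
  cocycles E k ⧸ coboundaries E k

/-- The class in `F H^k(E; ℤ[ℤ])` of a cocycle. -/
noncomputable def classOf (E : Cplx.{u}) (k : ℤ) :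
    cocycles E k →ₗ[GroupRing] FreeQuot (Cohomology E k) :=
  (intTorsion (Cohomology E k)).mkQ ∘ₗ (coboundaries E k).mkQ

/-- The map `C_i → D_j` which is `f_i` if `i = j`, and zero otherwise. -/
noncomputable def shiftedMap {C D : Cplx.{u}} (f : C ⟶ D) (i j : ℤ) :
    C.X i →ₗ[GroupRing] D.X j :=
  if h : i = j then (f.f i ≫ (D.XIsoOfEq h).hom).hom else 0

lemma shiftedMap_self {C D : Cplx.{u}} (f : C ⟶ D) (i : ℤ) :
    shiftedMap f i i = (f.f i).hom := by
  simp [shiftedMap]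

/-- The differential of the mapping cone:
`(x, y) ↦ (d x + (-1)^(i-1) f y, d y)` from `D_i ⊕ C_{i-1}` to `D_j ⊕ C_{j-1}`, `j = i - 1`. -/
noncomputable def coneDiff {C D : Cplx.{u}} (f : C ⟶ D) (i j : ℤ) :
    (D.X i × C.X (i - 1)) →ₗ[GroupRing] (D.X j × C.X (j - 1)) :=
  ((D.d i j).hom.coprod ((i - 1).negOnePow • shiftedMap f (i - 1) j)).prod
    ((C.d (i - 1) (j - 1)).hom ∘ₗ LinearMap.snd GroupRing (D.X i) (C.X (i - 1)))

/-- The algebraic mapping cone of `f : C ⟶ D`, with `cone(f)_r = D_r ⊕ C_{r-1}`. -/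
noncomputable def cone {C D : Cplx.{u}} (f : C ⟶ D) : Cplx.{u} where
  X r := ModuleCat.of GroupRing (D.X r × C.X (r - 1))
  d i j := ModuleCat.ofHom (coneDiff f i j)
  shape i j hij := by
    have h : j + 1 ≠ i := hij
    have h1 : D.d i j = 0 := D.shape i j hij
    have h2 : C.d (i - 1) (j - 1) = 0 := C.shape _ _ (by simpa using fun h' => h (by lia))
    have h3 : shiftedMap f (i - 1) j = 0 := by
      rw [shiftedMap, dif_neg (by lia)]
    ext x <;> simp [coneDiff, h1, h2, h3]
  d_comp_d' i j k hij hjk := by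
    have hij' : j = i - 1 := eq_sub_of_add_eq hij
    have hjk' : k = j - 1 := eq_sub_of_add_eq hjk
    subst hij' hjk'
    have hD : ∀ x, (D.d (i - 1) (i - 1 - 1)).hom ((D.d i (i - 1)).hom x) = 0 := fun x => by
      rw [← ModuleCat.comp_apply, D.d_comp_d]; rfl
    have hC : ∀ x, (C.d (i - 1 - 1) (i - 1 - 1 - 1)).hom ((C.d (i - 1) (i - 1 - 1)).hom x) = 0 :=
      fun x => by rw [← ModuleCat.comp_apply, C.d_comp_d]; rfl
    have hf : ∀ x, (D.d (i - 1) (i - 1 - 1)).hom ((f.f (i - 1)).hom x) =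
        (f.f (i - 1 - 1)).hom ((C.d (i - 1) (i - 1 - 1)).hom x) := fun x => by
      rw [← ModuleCat.comp_apply, ← ModuleCat.comp_apply, f.comm]
    refine ModuleCat.hom_ext (LinearMap.ext fun x => ?_)
    refine Prod.ext ?_ ?_
    · simp [coneDiff, shiftedMap_self, hD, hf, Int.negOnePow_sub]
    · simp [coneDiff, hC]

/-- The inclusion of `D_r` in `cone(f)_r`. -/
noncomputable def coneInl {C D : Cplx.{u}} (f : C ⟶ D) (r : ℤ) :
    D.X r →ₗ[GroupRing] (cone f).X r :=
  LinearMap.inl GroupRing (D.X r) (C.X (r - 1))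

/-- The inclusion of `C_{r-1}` in `cone(f)_r`. -/
noncomputable def coneInr {C D : Cplx.{u}} (f : C ⟶ D) (r : ℤ) :
    C.X (r - 1) →ₗ[GroupRing] (cone f).X r :=
  LinearMap.inr GroupRing (D.X r) (C.X (r - 1))

lemma cone_d_inl {C D : Cplx.{u}} (f : C ⟶ D) (i j : ℤ) (w : D.X i) :
    ((cone f).d i j).hom (coneInl f i w) = coneInl f j ((D.d i j).hom w) := by
  change coneDiff f i j (w, 0) = ((D.d i j).hom w, 0)
  simp [coneDiff]

lemma cone_d_inr {C D : Cplx.{u}} (f : C ⟶ D) (i j : ℤ) (w : C.X (i - 1)) :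
    ((cone f).d i j).hom (coneInr f i w) =
      coneInl f j ((i - 1).negOnePow • shiftedMap f (i - 1) j w) +
        coneInr f j ((C.d (i - 1) (j - 1)).hom w) := by
  change coneDiff f i j (0, w) = ((i - 1).negOnePow • shiftedMap f (i - 1) j w, 0) +
    (0, (C.d (i - 1) (j - 1)).hom w)
  have h : coneDiff f i j (0, w) =
      ((i - 1).negOnePow • shiftedMap f (i - 1) j w, (C.d (i - 1) (j - 1)).hom w) := by
    simp [coneDiff]
  exact h.trans (Prod.ext (add_zero _).symm (zero_add _).symm)

/-- The `n`-dual complex `E^{n-*}`, with `(E^{n-*})_r = E^{n-r}` and differential `(-1)^r d*`. -/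
noncomputable def dualComplex (E : Cplx.{u}) (n : ℤ) : Cplx.{u} where
  X r := ModuleCat.of GroupRing (ConjDual (E.X (n - r)))
  d i j := ModuleCat.ofHom (i.negOnePow • codiff E (n - i) (n - j))
  shape i j hij := by
    have h : j + 1 ≠ i := hij
    have h1 : E.d (n - j) (n - i) = 0 :=
      E.shape _ _ (show ¬ (n - i + 1 = n - j) from fun h' => h (by lia))
    have h2 : codiff E (n - i) (n - j) = 0 := by
      refine LinearMap.ext fun x => ConjDual.ext fun w => ?_
      simp [h1]
    refine ModuleCat.hom_ext (LinearMap.ext fun x => ?_)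
    simp [h2]
  d_comp_d' i j k _ _ := by
    refine ModuleCat.hom_ext (LinearMap.ext fun x => ?_)
    have h : codiff E (n - j) (n - k) (codiff E (n - i) (n - j) x) = 0 := by
      refine ConjDual.ext fun w => ?_
      have h1 : (E.d (n - j) (n - i)).hom ((E.d (n - k) (n - j)).hom w) = 0 := by
        rw [← ModuleCat.comp_apply, E.d_comp_d]
        rfl
      simp [h1]
    simp [h]

/-! ### Symmetric structures -/

section Symmetric

variable (C : Cplx.{u}) [∀ r, Module.Finite GroupRing (C.X r)]
  [∀ r, Module.Projective GroupRing (C.X r)]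

/-- A collection of homomorphisms `φ_s : C^p → C_q` for `s ≥ 0` and all `p`, `q`. -/
abbrev HomFamily (C : Cplx.{u}) : Type u :=
  ∀ (_ : ℕ) (p q : ℤ), ConjDual (C.X p) →ₗ[GroupRing] C.X q

/-- For a collection `φ_s : C^{n-r+s} → C_r` the homomorphisms
`d φ_s + (-1)^q φ_s d* + (-1)^(n+s-1) (φ_{s-1} + (-1)^s T φ_{s-1}) : C^p → C_q`, of interest for
`p + q = n + s - 1`. Here `φ_{-1} = 0`, and `T ψ = (-1)^(pq) ψ*` is the transposition from
`Hom(C^q, C_p)` to `Hom(C^p, C_q)`. -/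
noncomputable def symmetricBoundary (n : ℕ) (φ : HomFamily C) (s : ℕ) (p q : ℤ) :
    ConjDual (C.X p) →ₗ[GroupRing] C.X q :=
  (C.d (q + 1) q).hom ∘ₗ φ s p (q + 1) + q.negOnePow • (φ s (p + 1) q ∘ₗ codiff C p (p + 1)) +
    match s with
    | 0 => 0
    | s' + 1 => ((n : ℤ) + s').negOnePow •
        (φ s' p q + ((s' : ℤ) + 1).negOnePow • ((p * q).negOnePow • ConjDual.transpose (φ s' q p)))

/-- An `n`-dimensional symmetric structure on `C` (more precisely, a cycle representing one). -/
structure SymmetricStructure (n : ℕ) where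
  /-- The homomorphisms `φ_s : C^{n-r+s} → C_r`. -/
  φ : HomFamily C
  shape : ∀ (s : ℕ) (p q : ℤ), p + q ≠ n + s → φ s p q = 0
  rel : ∀ (s : ℕ) (p q : ℤ), symmetricBoundary C n φ s p q = 0

end Symmetric

section Pair

variable {C D : Cplx.{u}} [∀ r, Module.Finite GroupRing (C.X r)]
  [∀ r, Module.Projective GroupRing (C.X r)] [∀ r, Module.Finite GroupRing (D.X r)]
  [∀ r, Module.Projective GroupRing (D.X r)]

/-- An `(n+1)`-dimensional symmetric structure `(δφ, φ)` on a chain map `f : C ⟶ D` (more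
precisely, a cycle representing one). -/
structure SymmetricPair (f : C ⟶ D) (n : ℕ) extends SymmetricStructure C n where
  /-- The homomorphisms `δφ_s : D^{n+1-r+s} → D_r`. -/
  δφ : HomFamily D
  shape_pair : ∀ (s : ℕ) (p q : ℤ), p + q ≠ n + 1 + s → δφ s p q = 0
  rel_pair : ∀ (s : ℕ) (p q : ℤ), symmetricBoundary D (n + 1) δφ s p q +
    (n : ℤ).negOnePow • ((f.f q).hom ∘ₗ φ s p q ∘ₗ ConjDual.map (f.f p).hom) = 0

/-- The homomorphism `(δφ_0  f φ_0) : cone(f)^p = D^p ⊕ C^{p-1} → D_q`, of interest for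
`p + q = n + 1`. -/
noncomputable def dualityMap {f : C ⟶ D} {n : ℕ} (Q : SymmetricPair f n) (p q : ℤ) :
    ConjDual ((cone f).X p) →ₗ[GroupRing] D.X q :=
  Q.δφ 0 p q ∘ₗ ConjDual.map (coneInl f p) +
    (f.f q).hom ∘ₗ Q.φ 0 (p - 1) q ∘ₗ ConjDual.map (coneInr f p)

lemma negOnePow_smul_eq {M : Type u} [AddCommGroup M] [Module GroupRing M] (k : ℤ) (x : M) :
    k.negOnePow • x = ((k.negOnePow : ℤ) : GroupRing) • x := by
  rcases Int.even_or_odd k with h | h <;> simp [Int.negOnePow_even, Int.negOnePow_odd, h]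

lemma d_dualityMap {f : C ⟶ D} {n : ℕ} (Q : SymmetricPair f n) (p q : ℤ) (h : p + q = n)
    (x : ConjDual ((cone f).X p)) :
    (D.d (q + 1) q).hom (dualityMap Q p (q + 1) x) =
      (q + 1).negOnePow • dualityMap Q (p + 1) q (codiff (cone f) p (p + 1) x) := by
  obtain ⟨a, ha⟩ : ∃ a, a = ConjDual.map (coneInl f p) x := ⟨_, rfl⟩
  obtain ⟨b, hb⟩ : ∃ b, b = ConjDual.map (coneInr f p) x := ⟨_, rfl⟩
  have h1 : ConjDual.map (coneInl f (p + 1)) (codiff (cone f) p (p + 1) x) =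
      codiff D p (p + 1) a := by
    refine ConjDual.ext fun w => ?_
    simp [ha, cone_d_inl]
  have h2 : ∀ (e : ℤ) (c : ConjDual (C.X e)), e = p →
      (∀ w, c w = a (e.negOnePow • shiftedMap f e p w) + b ((C.d e (p - 1)).hom w)) →
      Q.φ 0 e q c = p.negOnePow • Q.φ 0 p q (ConjDual.map (f.f p).hom a) +
        Q.φ 0 p q (codiff C (p - 1) p b) := by
    intro e c he hc
    subst he
    have : c = e.negOnePow • ConjDual.map (f.f e).hom a + codiff C (e - 1) e b := by
      refine ConjDual.ext fun w => ?_
      rw [hc, shiftedMap_self, negOnePow_smul_eq, negOnePow_smul_eq]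
      simp
    rw [this, map_add, negOnePow_smul_eq, negOnePow_smul_eq, map_smul]
  have h3 := h2 (p + 1 - 1) (ConjDual.map (coneInr f (p + 1))
      (codiff (cone f) p (p + 1) x)) (by lia) (fun w => by
    simp only [ConjDual.map_apply, cone_d_inr, map_add, ha, hb])
  have h4 := LinearMap.congr_fun (Q.rel_pair 0 p q) a
  have h5 : ∀ e : ℤ, e = p → (C.d (q + 1) q).hom (Q.φ 0 (p - 1) (q + 1) b) +
      q.negOnePow • Q.φ 0 e q (codiff C (p - 1) e b) = 0 := by
    intro e he
    obtain rfl : e = p - 1 + 1 := by lia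
    simpa [symmetricBoundary] using LinearMap.congr_fun (Q.rel 0 (p - 1) q) b
  have h5 := congrArg (f.f q).hom (h5 p rfl)
  have hf : ∀ w, (D.d (q + 1) q).hom ((f.f (q + 1)).hom w) =
        (f.f q).hom ((C.d (q + 1) q).hom w) := fun w => by
      rw [← ModuleCat.comp_apply, ← ModuleCat.comp_apply, f.comm]
  simp only [dualityMap, LinearMap.add_apply, LinearMap.comp_apply, h1, h3, ← ha, ← hb, map_add, hf]
  simp only [symmetricBoundary, LinearMap.add_apply, LinearMap.comp_apply,
    LinearMap.smul_apply, LinearMap.zero_apply, map_add, map_zero, add_zero] at h4 h5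
  rw [eq_neg_of_add_eq_zero_left h5, ← sub_eq_zero, ← h4]
  obtain rfl : p = n - q := by lia
  rcases Int.even_or_odd q with h6 | h6 <;> rcases Int.even_or_odd (n : ℤ) with h7 | h7 <;>
    simp [Int.negOnePow_sub, Int.negOnePow_even, Int.negOnePow_odd, h6, h7] <;>
    abel

/-- The chain map `(δφ_0  f φ_0) : cone(f)^{n+1-*} → D`. -/
noncomputable def dualityHom {f : C ⟶ D} {n : ℕ} (Q : SymmetricPair f n) :
    dualComplex (cone f) (n + 1) ⟶ D where
  f r := ModuleCat.ofHom (dualityMap Q (n + 1 - r) r)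
  comm' i j hij := by
    have hij' : i = j + 1 := hij.symm
    subst hij'
    refine ModuleCat.hom_ext (LinearMap.ext fun x => ?_)
    obtain ⟨p, hp⟩ : ∃ p, p = (n : ℤ) + 1 - (j + 1) := ⟨_, rfl⟩
    obtain ⟨p', hp'⟩ : ∃ p', p' = (n : ℤ) + 1 - j := ⟨_, rfl⟩
    change (D.d (j + 1) j).hom (dualityMap Q (n + 1 - (j + 1)) (j + 1) x) =
      dualityMap Q (n + 1 - j) j
        ((j + 1).negOnePow • codiff (cone f) (n + 1 - (j + 1)) (n + 1 - j) x)
    revert x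
    change ∀ x : ConjDual ((cone f).X (n + 1 - (j + 1))), _
    rw [← hp, ← hp']
    intro x
    obtain rfl : p' = p + 1 := by lia
    rw [d_dualityMap Q p j (by lia), negOnePow_smul_eq, negOnePow_smul_eq, map_smul]

/-- The pair is Poincaré if `(δφ_0  f φ_0)` is a chain homotopy equivalence. -/
def SymmetricPair.IsPoincare {f : C ⟶ D} {n : ℕ} (Q : SymmetricPair f n) : Prop :=
  ∃ e : HomotopyEquiv (dualComplex (cone f) (n + 1)) D, e.hom = dualityHom Q

end Pair

/-! ### Pairings -/

section Pairing

variable {A B : Type u} [AddCommGroup A] [Module GroupRing A] [AddCommGroup B]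
  [Module GroupRing B]

/-- A pairing `β : A × B → ℚ(ℤ)/ℤ[ℤ]` with `β (a x) (b y) = conj a * b * β x y` is nonsingular if
its adjoints `A → Hom(B, ℚ(ℤ)/ℤ[ℤ])` and `B → Hom(A, ℚ(ℤ)/ℤ[ℤ])` are isomorphisms. -/
def IsNonsingular (β : A →ₛₗ[conj] B →ₗ[GroupRing] FracMod) : Prop :=
  Function.Bijective β ∧ Function.Bijective β.flip

end Pairing

section Blanchfield

variable {C D : Cplx.{u}} [∀ r, Module.Finite GroupRing (C.X r)]
  [∀ r, Module.Projective GroupRing (C.X r)] [∀ r, Module.Finite GroupRing (D.X r)]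
  [∀ r, Module.Projective GroupRing (D.X r)]

/-- The defining formula of the Blanchfield pairing: if `x`, `y` are cocycles, `p ≠ 0` and
`z (d w) = p * x w` for all `w`, then `Bl([x], [y])` is the class of `z (Φ y) / p`, where
`Φ y = δφ_0 (y|D) + f φ_0 (y|C)` is the cycle in `D_{i-1}` dual to `y`. -/
def IsBlanchfieldPairing {f : C ⟶ D} {m : ℕ} (Q : SymmetricPair f m) (i : ℤ)
    (Bl : FreeQuot (Cohomology D i) →ₛₗ[conj]
      FreeQuot (Cohomology (cone f) (m - i + 2)) →ₗ[GroupRing] FracMod) : Prop :=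
  ∀ (x : cocycles D i) (y : cocycles (cone f) (m - i + 2)) (p : GroupRing)
    (z : ConjDual (D.X (i - 1))), p ≠ 0 →
    (∀ w : D.X i, z ((D.d i (i - 1)).hom w) = p * (x : ConjDual (D.X i)) w) →
    Bl (classOf D i x) (classOf (cone f) (m - i + 2) y) =
      Submodule.Quotient.mk (algebraMap GroupRing FracField
        (z (dualityMap Q (m - i + 2) (i - 1) y)) / algebraMap GroupRing FracField p)

end Blanchfield

end Blanchfield

/-!
The group ring `Λ = ℤ[ℤ]` has global dimension two. The pairing is the linking form: a cocycle `x`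
of degree `i` and a cycle `c` of `D` of degree `i - 1` have linking number `x w / p`, where
`d w = p c`, and Poincaré duality identifies the classes of `c` with the cohomology of the cone.
Instead of the universal coefficient spectral sequence, the proof works with cycles and cocycles,
using two facts about a linear map `g` between finitely generated projective `Λ`-modules.

* The kernel of `g` is projective (`projective_ker`). Hence a homomorphism from the cycles, or from
  the cocycles, to `ℚ(ℤ)/Λ` lifts to `ℚ(ℤ)`, and the lift is a linking form. This makes both
  adjoints surjective (`exists_linking_eq_of_hom`, `exists_linking_eq_of_dual_hom`).
* Up to a nonzero integer, the kernel and the image of `g` are direct summands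
  (`exists_section_up_to_int`), because `ℚ[t, t⁻¹]` is a principal ideal domain. Hence a cocycle or
  a cycle with integral linking numbers vanishes in (co)homology up to `ℤ`-torsion, so both adjoints
  are injective after passing to the quotients `F`
  (`exists_int_primitive_of_linking_mem`, `exists_int_boundary_of_linking_mem`).

Conversely, linking numbers with `ℤ`-torsion classes are integral: they have denominators `p` with
`p(1) = ±1` and `n ∈ ℤ`, which are coprime by Gauss's lemma (`mem_integers_of_smul_mem`). Duality
is used on the level of elements (`exists_dualityMap_eq`, `exists_codiff_eq`), and the pairing of
cochains descends to classes by `exists_nonsingular_of_kernels`.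
-/

namespace Blanchfield

/-! ### Free modules over principal ideal domains -/

section PrincipalIdealDomain

variable {R : Type*} [CommRing R] [IsDomain R] [IsPrincipalIdealRing R]

/-- The basis is made of elements with minimal leading coefficient (for divisibility), one for
each index that occurs as a leading index. -/
lemma free_submodule_finsupp {ι : Type*} [LinearOrder ι] [WellFoundedLT ι]
    (N : Submodule R (ι →₀ R)) : Module.Free R N := by
  classical
  let I : ι → Ideal R := fun i =>
    (N ⊓ Finsupp.supported R R (Set.Iic i)).map (Finsupp.lapply i)
  let a : ι → R := fun i => Submodule.IsPrincipal.generator (I i)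
  have ha : ∀ i, ∃ x ∈ N ⊓ Finsupp.supported R R (Set.Iic i), x i = a i := fun i =>
    Submodule.IsPrincipal.generator_mem (I i)
  choose v hv hva using ha
  have hv0 : ∀ i j, i < j → v i j = 0 := fun i j hij => by
    by_contra h
    exact absurd ((Finsupp.mem_supported R _).1 (hv i).2 (Finsupp.mem_support_iff.2 h))
      (not_le.2 hij)
  let w : {i // a i ≠ 0} → (ι →₀ R) := fun i => v i
  have hli : LinearIndependent R w := by
    rw [linearIndependent_iff']
    intro s c hc
    by_contra! hne
    obtain ⟨j, hjs, hj⟩ := hne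
    obtain ⟨k, hk, hmax⟩ := (s.filter (fun j => c j ≠ 0)).exists_max_image id
      ⟨j, Finset.mem_filter.2 ⟨hjs, hj⟩⟩
    rw [Finset.mem_filter] at hk
    have h := DFunLike.congr_fun hc (k : ι)
    rw [Finsupp.finsetSum_apply, Finset.sum_eq_single k] at h
    · exact mul_ne_zero hk.2 k.2 (by simpa [w, hva] using h)
    · intro i hi hik
      by_cases h0 : c i = 0
      · simp [h0]
      · have hlt : i < k := lt_of_le_of_ne (hmax i (Finset.mem_filter.2 ⟨hi, h0⟩)) hik
        simp [w, hv0 i k hlt]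
    · exact fun h' => absurd hk.1 h'
  have hspan : Submodule.span R (Set.range w) = N := by
    refine le_antisymm (Submodule.span_le.2 ?_) ?_
    · rintro _ ⟨i, rfl⟩
      exact (hv i).1
    have key : ∀ i, ∀ x ∈ N, x ∈ Finsupp.supported R R (Set.Iic i) →
        x ∈ Submodule.span R (Set.range w) := by
      intro i
      induction i using WellFoundedLT.induction with
      | ind i ih =>
        intro x hxN hxi
        obtain ⟨c, hc⟩ : ∃ c, x i = c * a i := by
          have : x i ∈ I i := ⟨x, ⟨hxN, hxi⟩, rfl⟩
          obtain ⟨c, hc⟩ := (Submodule.IsPrincipal.mem_iff_eq_smul_generator (I i)).1 this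
          exact ⟨c, hc⟩
        have hci : c • v i ∈ N ⊓ Finsupp.supported R R (Set.Iic i) :=
          Submodule.smul_mem _ c (hv i)
        obtain ⟨y, hy, hyw, hyi⟩ : ∃ y ∈ N ⊓ Finsupp.supported R R (Set.Iic i),
            y ∈ Submodule.span R (Set.range w) ∧ y i = x i := by
          by_cases h0 : a i = 0
          · exact ⟨0, Submodule.zero_mem _, Submodule.zero_mem _, by simp [hc, h0]⟩
          · exact ⟨c • v i, hci, Submodule.smul_mem _ _ (Submodule.subset_span ⟨⟨i, h0⟩, rfl⟩),
              by simp [hc, hva]⟩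
        rw [← sub_add_cancel x y]
        refine Submodule.add_mem _ ?_ hyw
        by_cases h0 : x - y = 0
        · rw [h0]
          exact Submodule.zero_mem _
        have hsupp : (x - y).support.Nonempty := Finsupp.support_nonempty_iff.2 h0
        have hxy : x - y ∈ Finsupp.supported R R (Set.Iic i) := Submodule.sub_mem _ hxi hy.2
        have hmem := (x - y).support.max'_mem hsupp
        refine ih ((x - y).support.max' hsupp) (lt_of_le_of_ne
          ((Finsupp.mem_supported R _).1 hxy hmem) fun he => ?_) _
          (Submodule.sub_mem _ hxN hy.1) ((Finsupp.mem_supported R _).2 fun j hj =>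
            Finset.le_max' _ j hj)
        rw [he] at hmem
        exact Finsupp.mem_support_iff.1 hmem (by simp [hyi])
    intro x hx
    by_cases h0 : x = 0
    · rw [h0]
      exact Submodule.zero_mem _
    · exact key (x.support.max' (Finsupp.support_nonempty_iff.2 h0)) x hx
        ((Finsupp.mem_supported R _).2 fun j hj => Finset.le_max' _ j hj)
  have := Module.Free.of_basis (Module.Basis.span hli)
  exact Module.Free.of_equiv (LinearEquiv.ofEq _ _ hspan)

/-- A submodule of a free module over a principal ideal domain is free; no finiteness is
assumed. -/
lemma free_of_injective {M N : Type*} [AddCommGroup M] [Module R M] [AddCommGroup N] [Module R N]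
    [Module.Free R M] (g : N →ₗ[R] M) (hg : Function.Injective g) : Module.Free R N := by
  obtain ⟨_, _⟩ := exists_wellFoundedLT (Module.Free.ChooseBasisIndex R M)
  let g' := (Module.Free.chooseBasis R M).repr.toLinearMap ∘ₗ g
  have hg' : Function.Injective g' := (Module.Free.chooseBasis R M).repr.injective.comp hg
  have := free_submodule_finsupp (LinearMap.range g')
  exact Module.Free.of_equiv (LinearEquiv.ofInjective g' hg').symm

end PrincipalIdealDomain

/-! ### Second syzygies over the group ring are projective -/

/-- A form of Schanuel's lemma. -/
lemma projective_ker_of_projective_ker {R L P N : Type*} [Ring R] [AddCommGroup L] [Module R L]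
    [AddCommGroup P] [Module R P] [AddCommGroup N] [Module R N] [Module.Projective R L]
    [Module.Projective R P] (g : L →ₗ[R] N) (hg : Function.Surjective g) (π : P →ₗ[R] N)
    (hπ : Function.Surjective π) [Module.Projective R (LinearMap.ker π)] :
    Module.Projective R (LinearMap.ker g) := by
  obtain ⟨h, hh⟩ := Module.projective_lifting_property g π hg
  obtain ⟨k, hk⟩ := Module.projective_lifting_property π g hπ
  have hh' : ∀ x, g (h x) = π x := LinearMap.congr_fun hh
  have hk' : ∀ x, π (k x) = g x := LinearMap.congr_fun hk
  let i : LinearMap.ker g →ₗ[R] LinearMap.ker π × L :=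
    ((k ∘ₗ (LinearMap.ker g).subtype).codRestrict _ fun z => by simp [hk']).prod
      (LinearMap.ker g).subtype
  let s : LinearMap.ker π × L →ₗ[R] LinearMap.ker g :=
    ((h ∘ₗ (LinearMap.ker π).subtype).coprod (LinearMap.id - h ∘ₗ k)).codRestrict _ fun z => by
      simp [hh', hk']
  refine Module.Projective.of_split i s (LinearMap.ext fun z => Subtype.ext ?_)
  change h (k z) + ((z : L) - h (k z)) = z
  abel

section Resolution

open TensorProduct LaurentPolynomial

variable (N : Type*) [AddCommGroup N]

/-- The coefficient of `t ^ k` in an element of `ℤ[ℤ] ⊗ N = N[t, t⁻¹]`. -/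
noncomputable def tensorCoeff (k : ℤ) : GroupRing ⊗[ℤ] N →+ N :=
  TensorProduct.liftAddHom
    { toFun a := AddMonoidHom.mk' (fun n => a.coeff k • n) fun _ _ => smul_add _ _ _
      map_zero' := by ext; simp
      map_add' a b := by ext; simp [add_smul] }
    fun z a n => by
      change (z • a).coeff k • n = a.coeff k • z • n
      rw [AddMonoidAlgebra.coeff_smul, Finsupp.smul_apply, smul_eq_mul, mul_comm, mul_smul]

variable {N} in
lemma tensorCoeff_tmul (k : ℤ) (a : GroupRing) (n : N) :
    tensorCoeff N k (a ⊗ₜ n) = a.coeff k • n := rfl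

variable {N} in
lemma exists_sum_tensorCoeff (p : GroupRing ⊗[ℤ] N) : ∃ F : Finset ℤ,
    (∀ k ∉ F, tensorCoeff N k p = 0) ∧
      ∀ F', F ⊆ F' → p = ∑ k ∈ F', (T k : GroupRing) ⊗ₜ[ℤ] tensorCoeff N k p := by
  classical
  induction p with
  | zero => exact ⟨∅, by simp⟩
  | tmul a n =>
    refine ⟨a.coeff.support, fun k hk => ?_, fun F' hF => ?_⟩
    · rw [tensorCoeff_tmul, Finsupp.notMem_support_iff.1 hk, zero_smul]
    · have h : a = ∑ k ∈ F', a.coeff k • T k := by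
        ext j
        simp only [AddMonoidAlgebra.coeff_sum, Finsupp.finsetSum_apply, AddMonoidAlgebra.coeff_smul,
          Finsupp.smul_apply, T_apply, smul_eq_mul, mul_ite, mul_one, mul_zero,
          Finset.sum_ite_eq']
        split_ifs with hj
        · rfl
        · exact Finsupp.notMem_support_iff.1 fun h => hj (hF h)
      conv_lhs => rw [h, sum_tmul]
      refine Finset.sum_congr rfl fun k _ => ?_
      rw [tensorCoeff_tmul, tmul_smul, smul_tmul']
  | add x y hx hy =>
    obtain ⟨F, hF, hF'⟩ := hx
    obtain ⟨G, hG, hG'⟩ := hy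
    refine ⟨F ∪ G, fun k hk => ?_, fun F' h => ?_⟩
    · rw [Finset.notMem_union] at hk
      rw [map_add, hF k hk.1, hG k hk.2, add_zero]
    · simp only [map_add, tmul_add, Finset.sum_add_distrib]
      rw [← hF' F' (Finset.union_subset_left h), ← hG' F' (Finset.union_subset_right h)]

variable [Module GroupRing N]

/-- Multiplication by `t`, as a map of abelian groups. -/
noncomputable def mulT : N →ₗ[ℤ] N := (LinearMap.lsmul GroupRing N (T 1)).restrictScalars ℤ

/-- The endomorphism `t ⊗ 1 - 1 ⊗ t` of `ℤ[ℤ] ⊗ N`. -/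
noncomputable def resolutionMap : GroupRing ⊗[ℤ] N →ₗ[GroupRing] GroupRing ⊗[ℤ] N :=
  (T 1 : GroupRing) • LinearMap.id - (mulT N).baseChange GroupRing

/-- The action map `ℤ[ℤ] ⊗ N → N`. -/
noncomputable def actionMap : GroupRing ⊗[ℤ] N →ₗ[GroupRing] N :=
  LinearMap.liftBaseChange GroupRing (LinearMap.id : N →ₗ[ℤ] N)

variable {N}

lemma actionMap_tmul (a : GroupRing) (n : N) : actionMap N (a ⊗ₜ n) = a • n := by
  simp [actionMap]

lemma resolutionMap_tmul (a : GroupRing) (n : N) :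
    resolutionMap N (a ⊗ₜ n) = (T 1 * a) ⊗ₜ n - a ⊗ₜ ((T 1 : GroupRing) • n) := by
  simp [resolutionMap, mulT, TensorProduct.smul_tmul']

lemma actionMap_resolutionMap (p : GroupRing ⊗[ℤ] N) :
    actionMap N (resolutionMap N p) = 0 := by
  induction p with
  | zero => simp
  | tmul a n =>
    rw [resolutionMap_tmul, map_sub, actionMap_tmul, actionMap_tmul, smul_smul, mul_comm, sub_self]
  | add x y hx hy => rw [map_add, map_add, hx, hy, add_zero]

lemma T_tmul_sub_mem_range (k : ℤ) (n : N) :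
    (T k : GroupRing) ⊗ₜ[ℤ] n - 1 ⊗ₜ ((T k : GroupRing) • n) ∈
      LinearMap.range (resolutionMap N) := by
  induction k generalizing n with
  | zero => simp
  | succ k ih =>
    have h := Submodule.add_mem _ (LinearMap.mem_range_self (resolutionMap N) (T k ⊗ₜ n))
      (ih ((T 1 : GroupRing) • n))
    rw [resolutionMap_tmul, smul_smul, ← T_add, ← T_add, add_comm 1] at h
    simpa using h
  | pred k ih =>
    have h := Submodule.sub_mem _ (ih ((T (-1) : GroupRing) • n))
      (LinearMap.mem_range_self (resolutionMap N) (T (-k - 1) ⊗ₜ ((T (-1) : GroupRing) • n)))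
    rw [resolutionMap_tmul, smul_smul, smul_smul, ← T_add, ← T_add, ← T_add,
      show (1 : ℤ) + (-k - 1) = -k by ring, show (1 : ℤ) + -1 = 0 by ring, T_zero, one_smul,
      show -(k : ℤ) + -1 = -k - 1 by ring, sub_sub_sub_cancel_left] at h
    exact h

lemma ker_actionMap : LinearMap.ker (actionMap N) = LinearMap.range (resolutionMap N) := by
  refine le_antisymm (fun p hp => ?_) ?_
  · have key : ∀ p : GroupRing ⊗[ℤ] N, p - 1 ⊗ₜ actionMap N p ∈
        LinearMap.range (resolutionMap N) := by
      intro p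
      induction p with
      | zero => simp
      | tmul a n =>
        rw [actionMap_tmul]
        induction a using LaurentPolynomial.induction_on' with
        | add a b ha hb =>
          rw [add_smul, add_tmul, tmul_add, add_sub_add_comm]
          exact Submodule.add_mem _ ha hb
        | C_mul_T k z =>
          have h : (C z * T k : GroupRing) = z • T k := by
            rw [LaurentPolynomial.smul_eq_C_mul]
          rw [h, smul_assoc, tmul_smul, ← smul_tmul', ← smul_sub]
          exact zsmul_mem (T_tmul_sub_mem_range k n) z
      | add x y hx hy =>
        rw [map_add, tmul_add, add_sub_add_comm]
        exact Submodule.add_mem _ hx hy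
    have h := key p
    rwa [LinearMap.mem_ker.1 hp, tmul_zero, sub_zero] at h
  · rintro _ ⟨p, rfl⟩
    exact actionMap_resolutionMap p

lemma tensorCoeff_resolutionMap (k : ℤ) (p : GroupRing ⊗[ℤ] N) :
    tensorCoeff N (k + 1) (resolutionMap N p) =
      tensorCoeff N k p - (T 1 : GroupRing) • tensorCoeff N (k + 1) p := by
  induction p with
  | zero => simp
  | tmul a n =>
    rw [resolutionMap_tmul, map_sub, tensorCoeff_tmul, tensorCoeff_tmul, tensorCoeff_tmul,
      tensorCoeff_tmul, smul_comm (T 1 : GroupRing)]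
    congr 2
    rw [T, AddMonoidAlgebra.coeff_single_mul_eq_mul_coeff k (fun m _ => by lia), one_mul]
  | add x y hx hy =>
    rw [map_add, map_add, hx, hy, map_add, map_add, smul_add]
    abel

/-- The coefficients of an element of the kernel vanish in high degrees, hence, by the recursion
`hrec`, in all degrees. -/
lemma resolutionMap_injective : Function.Injective (resolutionMap N) := by
  rw [injective_iff_map_eq_zero]
  intro p hp
  obtain ⟨F, hF, hsum⟩ := exists_sum_tensorCoeff p
  have hrec : ∀ k, tensorCoeff N k p = (T 1 : GroupRing) • tensorCoeff N (k + 1) p := fun k => by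
    rw [← sub_eq_zero, ← tensorCoeff_resolutionMap, hp, map_zero]
  have hpos : ∀ (j : ℕ) (k : ℤ), tensorCoeff N (k + j) p = 0 → tensorCoeff N k p = 0 := by
    intro j
    induction j with
    | zero => intro k hk; simpa using hk
    | succ j ih =>
      intro k hk
      rw [hrec, ih (k + 1) (by rwa [add_assoc, add_comm 1, ← Nat.cast_succ]), smul_zero]
  have hzero : ∀ k, tensorCoeff N k p = 0 := by
    intro k
    obtain ⟨B, hB⟩ := F.bddAbove
    refine hpos (B + 1 - k).toNat k (hF _ fun h => ?_)
    have := hB h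
    have := Int.self_le_toNat (B + 1 - k)
    lia
  rw [hsum F subset_rfl]
  simp [hzero]

/-- Second syzygies over `ℤ[ℤ]` are projective, because `ℤ[ℤ]` has global dimension two. The image
`N` of `g` is free as an abelian group, so that `ℤ[ℤ] ⊗ N → ℤ[ℤ] ⊗ N → N` is a free resolution of
length one. -/
theorem projective_ker {L L' : Type*} [AddCommGroup L] [Module GroupRing L] [AddCommGroup L']
    [Module GroupRing L'] [Module.Projective GroupRing L] [Module.Projective GroupRing L']
    (g : L →ₗ[GroupRing] L') : Module.Projective GroupRing (LinearMap.ker g) := by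
  obtain ⟨s, hs⟩ := Module.projective_def'.1 ‹Module.Projective GroupRing L'›
  have hs' : Function.Injective s := Function.LeftInverse.injective
    (g := Finsupp.linearCombination GroupRing id) (LinearMap.congr_fun hs)
  have : Module.Free ℤ (L' →₀ GroupRing) := Module.Free.trans (S := GroupRing)
  have : Module.Free ℤ (LinearMap.range g) := free_of_injective
    ((s ∘ₗ (LinearMap.range g).subtype).restrictScalars ℤ)
    (hs'.comp Subtype.val_injective)
  have hfree : Module.Projective GroupRing (LinearMap.ker (actionMap (LinearMap.range g))) := by
    rw [ker_actionMap]
    exact Module.Projective.of_equiv (LinearEquiv.ofInjective _ resolutionMap_injective)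
  have hsurj : Function.Surjective (actionMap (LinearMap.range g)) := fun n =>
    ⟨1 ⊗ₜ n, by rw [actionMap_tmul, one_smul]⟩
  have := projective_ker_of_projective_ker g.rangeRestrict g.surjective_rangeRestrict _ hsurj
  rwa [LinearMap.ker_rangeRestrict] at this

end Resolution

/-! ### Inverting the nonzero integers -/

section Rationalization

open LaurentPolynomial

instance : IsNoetherianRing GroupRing :=
  IsLocalization.isNoetherianRing (Submonoid.powers (Polynomial.X : Polynomial ℤ)) GroupRing
    inferInstance

/-- The nonzero integers in `ℤ[ℤ]`. -/
noncomputable def nonzeroInts : Submonoid GroupRing :=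
  (nonZeroDivisors ℤ).map (algebraMap ℤ GroupRing)

lemma isPrincipalIdealRing_of_exists_unit_mul {A B : Type*} [CommRing A] [IsPrincipalIdealRing A]
    [CommRing B] (φ : A →+* B) (h : ∀ b : B, ∃ u : B, IsUnit u ∧ ∃ a, φ a = b * u) :
    IsPrincipalIdealRing B := by
  refine ⟨fun J => ⟨φ (Submodule.IsPrincipal.generator (J.comap φ)), ?_⟩⟩
  refine le_antisymm (fun b hb => ?_) ?_
  · obtain ⟨u, hu, a, ha⟩ := h b
    have haJ : a ∈ J.comap φ := by
      rw [Ideal.mem_comap, ha]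
      exact J.mul_mem_right u hb
    obtain ⟨c, rfl⟩ := (Submodule.IsPrincipal.mem_iff_eq_smul_generator (J.comap φ)).1 haJ
    refine Ideal.mem_span_singleton.2 (hu.dvd_mul_right.1 ⟨φ c, ?_⟩)
    rw [← ha, smul_eq_mul, map_mul, mul_comm]
  · rw [Submodule.span_singleton_le_iff_mem]
    exact Submodule.IsPrincipal.generator_mem (J.comap φ)

lemma isUnit_intCast_localization {n : ℤ} (hn : n ≠ 0) :
    IsUnit (n : Localization nonzeroInts) := by
  have h := IsLocalization.map_units (Localization nonzeroInts)
    (⟨algebraMap ℤ GroupRing n, n, mem_nonZeroDivisors_of_ne_zero hn, rfl⟩ : nonzeroInts)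
  simpa using h

/-- Inverting the nonzero integers in `ℤ[ℤ]` gives `ℚ[t, t⁻¹]`, a localization of `ℚ[X]`. -/
instance : IsPrincipalIdealRing (Localization nonzeroInts) := by
  let K := Localization nonzeroInts
  let c : ℚ →+* K := IsLocalization.lift (M := nonZeroDivisors ℤ) (g := Int.castRingHom K)
    fun n => isUnit_intCast_localization (nonZeroDivisors.ne_zero n.2)
  let ψ : Polynomial ℚ →+* K := Polynomial.eval₂RingHom c (algebraMap GroupRing K (T 1))
  have hψ : ψ.comp (Polynomial.mapRingHom (Int.castRingHom ℚ)) =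
      (algebraMap GroupRing K).comp Polynomial.toLaurent :=
    Polynomial.ringHom_ext' (RingHom.ext_int _ _) (by simp [ψ])
  refine isPrincipalIdealRing_of_exists_unit_mul ψ fun b => ?_
  obtain ⟨⟨a, s⟩, ha⟩ := IsLocalization.surj nonzeroInts b
  obtain ⟨n, a', ha'⟩ := exists_T_pow a
  refine ⟨algebraMap GroupRing K s * algebraMap GroupRing K (T n),
    (IsLocalization.map_units K s).mul ((isUnit_T _).map _), Polynomial.map (Int.castRingHom ℚ) a',
    ?_⟩
  have h := RingHom.congr_fun hψ a'
  rw [RingHom.comp_apply, RingHom.comp_apply, ha', map_mul] at h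
  rw [← mul_assoc]
  exact h.trans (congrArg (· * _) ha.symm)

lemma intCast_ne_zero {n : ℤ} (hn : n ≠ 0) : (n : GroupRing) ≠ 0 := fun h =>
  hn (by simpa using congrArg evalOne h)

lemma nonzeroInts_le : nonzeroInts ≤ nonZeroDivisors GroupRing := by
  rintro _ ⟨n, hn, rfl⟩
  exact mem_nonZeroDivisors_of_ne_zero (by simpa using intCast_ne_zero (nonZeroDivisors.ne_zero hn))

/-- After inverting the nonzero integers, a linear map between finitely generated projective
modules splits, since its image is then projective. Clearing denominators gives `σ`. -/
theorem exists_section_up_to_int {L L' : Type*} [AddCommGroup L] [Module GroupRing L]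
    [AddCommGroup L'] [Module GroupRing L'] [Module.Finite GroupRing L]
    [Module.Projective GroupRing L'] (g : L →ₗ[GroupRing] L') :
    ∃ (n : ℤ) (σ : L →ₗ[GroupRing] L), n ≠ 0 ∧ (∀ w, g w = 0 → σ w = 0) ∧
      ∀ w, g (σ w) = (n : GroupRing) • g w := by
  let N := LinearMap.range g
  let K := Localization nonzeroInts
  have : Module.FinitePresentation GroupRing N := Module.finitePresentation_of_finite _ _
  have : IsDomain K := IsLocalization.isDomain_localization nonzeroInts_le
  have : Module.Free K (LocalizedModule nonzeroInts N) := by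
    have : Module.Finite K (LocalizedModule nonzeroInts N) := Module.Finite.of_isLocalizedModule
      nonzeroInts (LocalizedModule.mkLinearMap nonzeroInts N)
    exact (Module.free_iff_isTorsionFree (R := K) (M := LocalizedModule nonzeroInts N)).2
      inferInstance
  obtain ⟨τ, hτ⟩ := Module.projective_lifting_property
    (LocalizedModule.map nonzeroInts g.rangeRestrict)
    (LinearMap.id : LocalizedModule nonzeroInts N →ₗ[K] _)
    (LocalizedModule.map_surjective _ _ g.surjective_rangeRestrict)
  obtain ⟨h, s, hs⟩ := Module.FinitePresentation.exists_lift_of_isLocalizedModule nonzeroInts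
    (LocalizedModule.mkLinearMap nonzeroInts L)
    (τ.restrictScalars GroupRing ∘ₗ LocalizedModule.mkLinearMap nonzeroInts N)
  obtain ⟨n, hn, hns⟩ := s.2
  have hsec : ∀ x : N, g.rangeRestrict (h x) = (s : GroupRing) • x := by
    intro x
    have hinj : Function.Injective (LocalizedModule.mkLinearMap nonzeroInts N) := by
      rw [injective_iff_map_eq_zero]
      intro x hx
      obtain ⟨c, hc⟩ := (IsLocalizedModule.eq_zero_iff nonzeroInts _).1 hx
      exact (smul_eq_zero.1 hc).resolve_left (nonZeroDivisors.ne_zero (nonzeroInts_le c.2))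
    refine hinj ?_
    have h1 := LinearMap.congr_fun hs x
    have h2 := congrArg (LocalizedModule.map nonzeroInts g.rangeRestrict) h1
    have h3 := LinearMap.congr_fun hτ (LocalizedModule.mkLinearMap nonzeroInts N x)
    simp only [LinearMap.comp_apply, LinearMap.smul_apply, LinearMap.id_apply] at h2 h3
    have h4 : LocalizedModule.mkLinearMap nonzeroInts N (g.rangeRestrict (h x)) =
        LocalizedModule.map nonzeroInts g.rangeRestrict
          (LocalizedModule.mkLinearMap nonzeroInts L (h x)) :=
      (LocalizedModule.map_mk nonzeroInts g.rangeRestrict (h x) 1).symm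
    have h5 : ∀ y, LocalizedModule.map nonzeroInts g.rangeRestrict ((s : GroupRing) • y) =
        (s : GroupRing) • LocalizedModule.map nonzeroInts g.rangeRestrict y := fun y =>
      map_smul ((LocalizedModule.map nonzeroInts g.rangeRestrict).restrictScalars GroupRing) _ y
    rw [h4, map_smul]
    exact h2.trans ((h5 _).trans (congrArg ((s : GroupRing) • ·) h3))
  refine ⟨n, h ∘ₗ g.rangeRestrict, nonZeroDivisors.ne_zero hn, fun w hw => ?_, fun w => ?_⟩
  · have : g.rangeRestrict w = 0 := Subtype.ext hw
    rw [LinearMap.comp_apply, this, map_zero]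
  · have h1 := congrArg Subtype.val (hsec (g.rangeRestrict w))
    rw [← hns] at h1
    simpa using h1

end Rationalization

/-! ### Denominators -/

section Denominators

open LaurentPolynomial

lemma evalOne_toLaurent (f : Polynomial ℤ) :
    evalOne (Polynomial.toLaurent f) = f.eval 1 := by
  rw [evalOne, eval₂_toLaurent, Polynomial.eval₂_id]
  rfl

lemma evalOne_T (n : ℤ) : evalOne (T n) = 1 := by
  rw [evalOne, eval₂_T, one_zpow, Units.val_one]

lemma ne_zero_of_mem_alexanderPolynomials {p : GroupRing} (hp : p ∈ alexanderPolynomials) :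
    p ≠ 0 := by
  rintro rfl
  rcases hp with h | h <;> simp at h

/-- By Gauss's lemma, a polynomial `p` with `p(1) = ±1` is coprime to every nonzero integer. -/
lemma intCast_dvd_of_dvd_mul {p : GroupRing} (hp : p ∈ alexanderPolynomials) {n : ℤ}
    {a : GroupRing} (h : (n : GroupRing) ∣ p * a) : (n : GroupRing) ∣ a := by
  obtain ⟨b, hb⟩ := h
  obtain ⟨i, p', hp'⟩ := exists_T_pow p
  obtain ⟨j, a', ha'⟩ := exists_T_pow a
  obtain ⟨k, b', hb'⟩ := exists_T_pow b
  have h1 : p' * a' * Polynomial.X ^ k = Polynomial.C n * b' * Polynomial.X ^ (i + j) := by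
    apply Polynomial.toLaurent_injective
    rw [map_mul, map_mul, map_mul, map_mul, hp', ha', hb', Polynomial.toLaurent_X_pow,
      Polynomial.toLaurent_X_pow, Polynomial.toLaurent_C, Nat.cast_add, T_add,
      show (C n : GroupRing) = (n : GroupRing) from map_intCast C n]
    linear_combination (T i * T j * T k) * hb
  have h2 : IsUnit p'.content := by
    have h3 : p'.content ∣ p'.eval 1 := by
      conv_rhs => rw [p'.eq_C_content_mul_primPart, Polynomial.eval_mul, Polynomial.eval_C]
      exact dvd_mul_right _ _
    rw [← evalOne_toLaurent, hp', map_mul, evalOne_T, mul_one] at h3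
    rcases hp with h | h <;> rw [h] at h3
    · exact isUnit_of_dvd_one h3
    · exact isUnit_of_dvd_unit h3 isUnit_one.neg
  have h3 : n ∣ a'.content := by
    have h4 := congrArg Polynomial.content h1
    rw [Polynomial.content_mul, Polynomial.content_mul, Polynomial.content_mul,
      Polynomial.content_mul, Polynomial.content_C, Polynomial.content_X_pow,
      Polynomial.content_X_pow, mul_one, mul_one] at h4
    rw [← h2.dvd_mul_left, h4]
    exact (associated_normalize n).dvd.mul_right _
  obtain ⟨e, rfl⟩ := Polynomial.dvd_content_iff_C_dvd.1 h3
  refine ⟨Polynomial.toLaurent e * T (-j), ?_⟩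
  rw [map_mul, Polynomial.toLaurent_C, show (C n : GroupRing) = (n : GroupRing) from
    map_intCast C n] at ha'
  rw [← mul_assoc, ha', mul_assoc, ← T_add, add_neg_cancel, T_zero, mul_one]

/-- The elements of `ℤ[ℤ]` in its field of fractions. -/
noncomputable abbrev integers : Submodule GroupRing FracField :=
  LinearMap.range (Algebra.linearMap GroupRing FracField)

/-- A fraction with the two coprime denominators `p` and `n` is integral. -/
lemma mem_integers_of_smul_mem {p : GroupRing} (hp : p ∈ alexanderPolynomials) {n : ℤ}
    (hn : n ≠ 0) {r : FracField} (hpr : p • r ∈ integers) (hnr : (n : GroupRing) • r ∈ integers) :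
    r ∈ integers := by
  obtain ⟨b, hb⟩ := hpr
  obtain ⟨a, ha⟩ := hnr
  rw [Algebra.linearMap_apply] at ha hb
  have h : p * a = n * b := by
    apply IsFractionRing.injective GroupRing FracField
    rw [map_mul, map_mul, ha, hb, Algebra.smul_def, Algebra.smul_def]
    ring
  obtain ⟨c, rfl⟩ := intCast_dvd_of_dvd_mul hp ⟨b, h⟩
  refine ⟨c, ?_⟩
  rw [Algebra.linearMap_apply]
  rw [map_mul, Algebra.smul_def] at ha
  exact mul_left_cancel₀ 
    (by simpa using (IsFractionRing.to_map_ne_zero_of_mem_nonZeroDivisors (K := FracField)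
      (mem_nonZeroDivisors_of_ne_zero (intCast_ne_zero hn)))) ha

end Denominators

/-! ### Linear algebra over the group ring -/

section LinearAlgebra

variable {M N : Type*} [AddCommGroup M] [Module GroupRing M] [AddCommGroup N] [Module GroupRing N]

/-- In a projective module, divisibility is detected by the functionals. -/
lemma exists_eq_smul_of_forall_dvd [Module.Projective GroupRing M] {p : GroupRing} {w : M}
    (h : ∀ e : Module.Dual GroupRing M, p ∣ e w) : ∃ w', w = p • w' := by
  obtain ⟨s, hs⟩ := Module.projective_def'.1 ‹Module.Projective GroupRing M›
  have hdvd : ∀ m : M, ∃ c, s w m = p * c := fun m => h (Finsupp.lapply m ∘ₗ s)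
  choose c hc using hdvd
  refine ⟨∑ m ∈ (s w).support, c m • m, ?_⟩
  have h1 : Finsupp.linearCombination GroupRing id (s w) = w := LinearMap.congr_fun hs w
  rw [Finsupp.linearCombination_apply] at h1
  refine h1.symm.trans ?_
  rw [Finsupp.sum, Finset.smul_sum]
  refine Finset.sum_congr rfl fun m _ => ?_
  rw [hc, mul_smul, id]

lemma exists_lift_of_mem_integers (l : M →ₗ[GroupRing] FracField) (h : ∀ y, l y ∈ integers) :
    ∃ l' : M →ₗ[GroupRing] GroupRing, ∀ y, algebraMap GroupRing FracField (l' y) = l y := by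
  let e := LinearEquiv.ofInjective (Algebra.linearMap GroupRing FracField)
    (IsFractionRing.injective GroupRing FracField)
  refine ⟨e.symm.toLinearMap ∘ₗ l.codRestrict integers h, fun y => ?_⟩
  exact congrArg Subtype.val (e.apply_symm_apply (l.codRestrict integers h y))

lemma exists_lift_fracMod [Module.Projective GroupRing M] (h : M →ₗ[GroupRing] FracMod) :
    ∃ l : M →ₗ[GroupRing] FracField, ∀ y, Submodule.Quotient.mk (l y) = h y := by
  obtain ⟨l, hl⟩ := Module.projective_lifting_property integers.mkQ h
    (Submodule.mkQ_surjective _)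
  exact ⟨l, LinearMap.congr_fun hl⟩

end LinearAlgebra

/-! ### The linking form of a complex with torsion homology -/

section Linking

variable {M₀ M₁ M₂ M₃ : Type*} [AddCommGroup M₀] [Module GroupRing M₀] [AddCommGroup M₁]
  [Module GroupRing M₁] [AddCommGroup M₂] [Module GroupRing M₂] [AddCommGroup M₃]
  [Module GroupRing M₃]
  (d₃ : M₃ →ₗ[GroupRing] M₂) (d₂ : M₂ →ₗ[GroupRing] M₁) (d₁ : M₁ →ₗ[GroupRing] M₀)
  (p : GroupRing)

/-- The linking number `x w / p ∈ ℚ(ℤ)` of a functional `x` on `M₂` and a cycle `y ∈ M₁`, where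
`d₂ w = p y`. It does not depend on the choice of `w` if `x` vanishes on the kernel of `d₂`, and
has no meaning if there is no such `w`. -/
noncomputable def linking (x : Module.Dual GroupRing M₂) (y : M₁) : FracField :=
  algebraMap GroupRing FracField (x (Classical.epsilon fun w => d₂ w = p • y)) /
    algebraMap GroupRing FracField p

variable {d₃ d₂ d₁ p}

lemma algebraMap_ne_zero {c : GroupRing} (hc : c ≠ 0) : algebraMap GroupRing FracField c ≠ 0 :=
  IsFractionRing.to_map_ne_zero_of_mem_nonZeroDivisors (mem_nonZeroDivisors_of_ne_zero hc)

section Formulas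

variable (hp : p ≠ 0) (hexact : ∀ y, d₁ y = 0 → ∃ w, d₂ w = p • y)
include hp hexact

lemma linking_eq {x : Module.Dual GroupRing M₂} (hx : ∀ w, d₂ w = 0 → x w = 0) {y : M₁}
    (hy : d₁ y = 0) {c : GroupRing} (hc : c ≠ 0) {w : M₂} (hw : d₂ w = c • y) :
    linking d₂ p x y = algebraMap GroupRing FracField (x w) / algebraMap GroupRing FracField c := by
  have h := Classical.epsilon_spec (hexact y hy)
  set v := Classical.epsilon fun w => d₂ w = p • y with hv
  have h1 := hx (c • v - p • w) (by
    rw [map_sub, map_smul, map_smul, h, hw, smul_comm, sub_self])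
  rw [map_sub, map_smul, map_smul, sub_eq_zero, smul_eq_mul, smul_eq_mul] at h1
  rw [linking, ← hv, div_eq_div_iff (algebraMap_ne_zero hp) (algebraMap_ne_zero hc), ← map_mul,
    ← map_mul, mul_comm, h1, mul_comm]

lemma linking_eq_of_primitive {x : Module.Dual GroupRing M₂} (hx : ∀ w, d₂ w = 0 → x w = 0) {y : M₁}
    (hy : d₁ y = 0) {c : GroupRing} (hc : c ≠ 0) {z : Module.Dual GroupRing M₁}
    (hz : ∀ w, z (d₂ w) = c * x w) :
    linking d₂ p x y = algebraMap GroupRing FracField (z y) / algebraMap GroupRing FracField c := by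
  obtain ⟨w, hw⟩ := hexact y hy
  have h := hz w
  rw [hw, map_smul, smul_eq_mul] at h
  rw [linking_eq hp hexact hx hy hp hw,
    div_eq_div_iff (algebraMap_ne_zero hp) (algebraMap_ne_zero hc), ← map_mul,
    ← map_mul, mul_comm, ← h, mul_comm]

lemma linking_add_right {x : Module.Dual GroupRing M₂} (hx : ∀ w, d₂ w = 0 → x w = 0) {y y' : M₁}
    (hy : d₁ y = 0) (hy' : d₁ y' = 0) :
    linking d₂ p x (y + y') = linking d₂ p x y + linking d₂ p x y' := by
  obtain ⟨w, hw⟩ := hexact y hy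
  obtain ⟨w', hw'⟩ := hexact y' hy'
  rw [linking_eq hp hexact hx hy hp hw, linking_eq hp hexact hx hy' hp hw',
    linking_eq hp hexact hx (y := y + y') (w := w + w') (by rw [map_add, hy, hy', add_zero]) hp
      (by rw [map_add, hw, hw', smul_add]), map_add, map_add, add_div]

lemma linking_smul_right {x : Module.Dual GroupRing M₂} (hx : ∀ w, d₂ w = 0 → x w = 0)
    (a : GroupRing) {y : M₁} (hy : d₁ y = 0) :
    linking d₂ p x (a • y) = a • linking d₂ p x y := by
  obtain ⟨w, hw⟩ := hexact y hy
  rw [linking_eq hp hexact hx hy hp hw,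
    linking_eq hp hexact hx (y := a • y) (w := a • w) (by rw [map_smul, hy, smul_zero]) hp
      (by rw [map_smul, hw, smul_comm]), map_smul, smul_eq_mul, map_mul, Algebra.smul_def,
      mul_div_assoc]

lemma mk_linking_boundary_add {x : Module.Dual GroupRing M₂} (hx : ∀ w, d₂ w = 0 → x w = 0)
    (hd : ∀ w, d₁ (d₂ w) = 0) (v : M₂) {y : M₁} (hy : d₁ y = 0) :
    (Submodule.Quotient.mk (linking d₂ p x (d₂ v + y)) : FracMod) =
      Submodule.Quotient.mk (linking d₂ p x y) := by
  have h : linking d₂ p x (d₂ v) ∈ integers := ⟨x v, by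
    rw [linking_eq hp hexact hx (hd v) one_ne_zero (one_smul _ _).symm, map_one, div_one,
      Algebra.linearMap_apply]⟩
  rw [linking_add_right hp hexact hx (hd v) hy, Submodule.Quotient.mk_add,
    (Submodule.Quotient.mk_eq_zero _).2 h, zero_add]

lemma exists_linkingHom {x : Module.Dual GroupRing M₂} (hx : ∀ w, d₂ w = 0 → x w = 0) :
    ∃ l : LinearMap.ker d₁ →ₗ[GroupRing] FracField, ∀ y, l y = linking d₂ p x y :=
  ⟨{ toFun y := linking d₂ p x y
     map_add' y y' := linking_add_right hp hexact hx y.2 y'.2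
     map_smul' a y := linking_smul_right hp hexact hx a y.2 }, fun _ => rfl⟩

/-- The functional `linking x` on the cycles extends to `M₁` up to a nonzero integer, because the
cycles are a direct summand of `M₁` once the nonzero integers are inverted. -/
lemma exists_int_primitive_of_linking_mem [Module.Finite GroupRing M₁]
    [Module.Projective GroupRing M₀] (hd : ∀ w, d₁ (d₂ w) = 0)
    {x : Module.Dual GroupRing M₂} (hx : ∀ w, d₂ w = 0 → x w = 0)
    (hint : ∀ y, d₁ y = 0 → linking d₂ p x y ∈ integers) :
    ∃ (n : ℤ) (z : Module.Dual GroupRing M₁), n ≠ 0 ∧ ∀ w, z (d₂ w) = n * x w := by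
  obtain ⟨n, σ, hn, hσ, hdσ⟩ := exists_section_up_to_int d₁
  obtain ⟨l, hl⟩ := exists_linkingHom hp hexact hx
  obtain ⟨l', hl'⟩ := exists_lift_of_mem_integers l fun y => by
    rw [hl]
    exact hint y y.2
  let r : M₁ →ₗ[GroupRing] LinearMap.ker d₁ :=
    ((n : GroupRing) • LinearMap.id - σ).codRestrict _ fun y => by simp [hdσ]
  refine ⟨n, l' ∘ₗ r, hn, fun w => ?_⟩
  have hr : r (d₂ w) = (n : GroupRing) • ⟨d₂ w, hd w⟩ := Subtype.ext (by simp [r, hσ _ (hd w)])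
  rw [LinearMap.comp_apply, hr, map_smul, smul_eq_mul]
  congr 1
  apply IsFractionRing.injective GroupRing FracField
  rw [hl', hl, linking_eq hp hexact hx (hd w) one_ne_zero (one_smul _ _).symm, map_one, div_one]

/-- Cocycles are coboundaries up to a nonzero scalar. -/
lemma exists_primitive [Module.Finite GroupRing M₁] [Module.Projective GroupRing M₀]
    (hd : ∀ w, d₁ (d₂ w) = 0) {x : Module.Dual GroupRing M₂} (hx : ∀ w, d₂ w = 0 → x w = 0) :
    ∃ (c : GroupRing) (z : Module.Dual GroupRing M₁), c ≠ 0 ∧ ∀ w, z (d₂ w) = c * x w := by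
  have hpx : ∀ w, d₂ w = 0 → (p • x) w = 0 := fun w hw => by
    rw [LinearMap.smul_apply, hx w hw, smul_zero]
  obtain ⟨n, z, hn, hz⟩ := exists_int_primitive_of_linking_mem hp hexact hd hpx fun y hy => by
    obtain ⟨w, hw⟩ := hexact y hy
    refine ⟨x w, ?_⟩
    rw [linking_eq hp hexact hpx hy hp hw, LinearMap.smul_apply, smul_eq_mul, map_mul,
      mul_div_cancel_left₀ _ (algebraMap_ne_zero hp), Algebra.linearMap_apply]
  refine ⟨n * p, z, mul_ne_zero (intCast_ne_zero hn) hp, fun w => ?_⟩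
  rw [hz, LinearMap.smul_apply, smul_eq_mul, mul_assoc]

/-- Every homomorphism from the homology of `M₁` to `ℚ(ℤ)/ℤ[ℤ]` is given by linking with a cocycle.
It lifts to a `ℚ(ℤ)`-valued functional on the cycles, which are projective. -/
lemma exists_linking_eq_of_hom [Module.Projective GroupRing M₁] [Module.Projective GroupRing M₀]
    (hd : ∀ w, d₁ (d₂ w) = 0) (h : LinearMap.ker d₁ →ₗ[GroupRing] FracMod)
    (hh : ∀ w, h ⟨d₂ w, hd w⟩ = 0) :
    ∃ x : Module.Dual GroupRing M₂, (∀ w, d₂ w = 0 → x w = 0) ∧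
      ∀ y : LinearMap.ker d₁, Submodule.Quotient.mk (linking d₂ p x y) = h y := by
  have := projective_ker d₁
  obtain ⟨l, hl⟩ := exists_lift_fracMod h
  obtain ⟨x, hx⟩ := exists_lift_of_mem_integers (l ∘ₗ d₂.codRestrict (LinearMap.ker d₁) hd)
    fun w => by
      rw [← Submodule.Quotient.mk_eq_zero, LinearMap.comp_apply, hl]
      exact hh w
  have hx0 : ∀ w, d₂ w = 0 → x w = 0 := fun w hw => by
    apply IsFractionRing.injective GroupRing FracField
    have : d₂.codRestrict (LinearMap.ker d₁) hd w = 0 := Subtype.ext hw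
    rw [hx, LinearMap.comp_apply, this, map_zero, map_zero]
  refine ⟨x, hx0, fun y => ?_⟩
  obtain ⟨w, hw⟩ := hexact y y.2
  have : d₂.codRestrict (LinearMap.ker d₁) hd w = p • y := Subtype.ext hw
  rw [linking_eq hp hexact hx0 y.2 hp hw, hx, LinearMap.comp_apply, this, map_smul,
    Algebra.smul_def, mul_div_cancel_left₀ _ (algebraMap_ne_zero hp), hl]

/-- A cycle whose linking numbers are all integral is a boundary up to a nonzero integer, because
the boundaries are projective once the nonzero integers are inverted. -/
lemma exists_int_boundary_of_linking_mem [Module.Finite GroupRing M₂]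
    [Module.Projective GroupRing M₂] [Module.Projective GroupRing M₁] {y : M₁} (hy : d₁ y = 0)
    (hint : ∀ x : Module.Dual GroupRing M₂, (∀ w, d₂ w = 0 → x w = 0) →
      linking d₂ p x y ∈ integers) :
    ∃ (n : ℤ) (w : M₂), n ≠ 0 ∧ d₂ w = (n : GroupRing) • y := by
  obtain ⟨n, σ, hn, hσ, hdσ⟩ := exists_section_up_to_int d₂
  obtain ⟨w, hw⟩ := hexact y hy
  obtain ⟨w', hw'⟩ := exists_eq_smul_of_forall_dvd (p := p) (w := σ w) fun e => by
    have hx : ∀ w, d₂ w = 0 → (e ∘ₗ σ) w = 0 := fun w hw => by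
      rw [LinearMap.comp_apply, hσ w hw, map_zero]
    obtain ⟨c, hc⟩ := hint (e ∘ₗ σ) hx
    rw [linking_eq hp hexact hx hy hp hw, Algebra.linearMap_apply,
      eq_div_iff (algebraMap_ne_zero hp), ← map_mul] at hc
    exact ⟨c, by rw [mul_comm, IsFractionRing.injective GroupRing FracField hc]; rfl⟩
  refine ⟨n, w', hn, smul_right_injective M₁ hp ?_⟩
  change p • d₂ w' = p • (n : GroupRing) • y
  rw [← map_smul, ← hw', hdσ, hw, smul_comm]

/-- Every homomorphism from the cohomology of `M₂` to `ℚ(ℤ)/ℤ[ℤ]` is given by linking with a cycle.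
It lifts to a `ℚ(ℤ)`-valued functional on the cocycles, which are projective, and the restriction
of the lift to the coboundaries is evaluation at an element of `M₁`, since `M₁` is reflexive. -/
lemma exists_linking_eq_of_dual_hom [Module.Finite GroupRing M₁] [Module.Projective GroupRing M₁]
    [Module.Projective GroupRing M₀] [Module.Finite GroupRing M₂] [Module.Projective GroupRing M₂]
    [Module.Finite GroupRing M₃] [Module.Projective GroupRing M₃]
    (hd : ∀ w, d₁ (d₂ w) = 0) (hd' : ∀ v, d₂ (d₃ v) = 0)
    (hx : ∀ x : Module.Dual GroupRing M₂, d₃.dualMap x = 0 → ∀ w, d₂ w = 0 → x w = 0)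
    (g : LinearMap.ker d₃.dualMap →ₗ[GroupRing] FracMod)
    (hg : ∀ (z : Module.Dual GroupRing M₁) (x : LinearMap.ker d₃.dualMap),
      (x : Module.Dual GroupRing M₂) = d₂.dualMap z → g x = 0) :
    ∃ y, d₁ y = 0 ∧ ∀ x : LinearMap.ker d₃.dualMap,
      Submodule.Quotient.mk (linking d₂ p x.1 y) = g x := by
  have := projective_ker d₃.dualMap
  obtain ⟨l, hl⟩ := exists_lift_fracMod (M := LinearMap.ker d₃.dualMap) g
  let δ : Module.Dual GroupRing M₁ →ₗ[GroupRing] LinearMap.ker d₃.dualMap :=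
    d₂.dualMap.codRestrict _ fun z => LinearMap.ext fun v => by simp [hd']
  obtain ⟨k, hk⟩ := exists_lift_of_mem_integers (l ∘ₗ δ) fun z => by
    rw [← Submodule.Quotient.mk_eq_zero, LinearMap.comp_apply, hl]
    exact hg z _ rfl
  have hy : ∀ z : Module.Dual GroupRing M₁, z ((Module.evalEquiv GroupRing M₁).symm k) = k z :=
    fun z => Module.apply_evalEquiv_symm_apply GroupRing M₁ z k
  set y := (Module.evalEquiv GroupRing M₁).symm k
  have hy0 : d₁ y = 0 := by
    rw [← Module.forall_dual_apply_eq_zero_iff GroupRing]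
    intro e
    apply IsFractionRing.injective GroupRing FracField
    have h1 : δ (e ∘ₗ d₁) = 0 := Subtype.ext (LinearMap.ext fun w =>
      (congrArg e (hd w)).trans (map_zero e))
    rw [← LinearMap.comp_apply, hy, hk, LinearMap.comp_apply, h1, map_zero, map_zero]
  refine ⟨y, hy0, fun x => ?_⟩
  have hx' := hx x.1 x.2
  obtain ⟨c, z, hc, hz⟩ := exists_primitive hp hexact hd hx'
  have h1 : δ z = c • x := Subtype.ext (LinearMap.ext hz)
  rw [linking_eq_of_primitive hp hexact hx' hy0 hc hz, hy, hk, LinearMap.comp_apply, h1, map_smul,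
    Algebra.smul_def, mul_div_cancel_left₀ _ (algebraMap_ne_zero hc), hl]

end Formulas

/-- Linking numbers with a cocycle that is a coboundary up to a nonzero integer are integral. -/
lemma linking_mem_of_int_primitive (hp : p ∈ alexanderPolynomials)
    (hexact : ∀ y, d₁ y = 0 → ∃ w, d₂ w = p • y) {x : Module.Dual GroupRing M₂}
    (hx : ∀ w, d₂ w = 0 → x w = 0) {n : ℤ} (hn : n ≠ 0) {z : Module.Dual GroupRing M₁}
    (hz : ∀ w, z (d₂ w) = n * x w) {y : M₁} (hy : d₁ y = 0) : linking d₂ p x y ∈ integers := by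
  have hp0 := ne_zero_of_mem_alexanderPolynomials hp
  obtain ⟨w, hw⟩ := hexact y hy
  refine mem_integers_of_smul_mem hp hn ⟨x w, ?_⟩ ⟨z y, ?_⟩
  · rw [linking_eq hp0 hexact hx hy hp0 hw, Algebra.smul_def,
      mul_div_cancel₀ _ (algebraMap_ne_zero hp0), Algebra.linearMap_apply]
  · rw [linking_eq_of_primitive hp0 hexact hx hy (intCast_ne_zero hn) hz, Algebra.smul_def,
      mul_div_cancel₀ _ (algebraMap_ne_zero (intCast_ne_zero hn)), Algebra.linearMap_apply]

/-- Linking numbers of a cycle that is a boundary up to a nonzero integer are integral. -/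
lemma linking_mem_of_int_boundary (hp : p ∈ alexanderPolynomials)
    (hexact : ∀ y, d₁ y = 0 → ∃ w, d₂ w = p • y) {x : Module.Dual GroupRing M₂}
    (hx : ∀ w, d₂ w = 0 → x w = 0) {n : ℤ} (hn : n ≠ 0) {y : M₁} (hy : d₁ y = 0) {w : M₂}
    (hw : d₂ w = (n : GroupRing) • y) : linking d₂ p x y ∈ integers := by
  have hp0 := ne_zero_of_mem_alexanderPolynomials hp
  obtain ⟨v, hv⟩ := hexact y hy
  refine mem_integers_of_smul_mem hp hn ⟨x v, ?_⟩ ⟨x w, ?_⟩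
  · rw [linking_eq hp0 hexact hx hy hp0 hv, Algebra.smul_def,
      mul_div_cancel₀ _ (algebraMap_ne_zero hp0), Algebra.linearMap_apply]
  · rw [linking_eq hp0 hexact hx hy (intCast_ne_zero hn) hw, Algebra.smul_def,
      mul_div_cancel₀ _ (algebraMap_ne_zero (intCast_ne_zero hn)), Algebra.linearMap_apply]

end Linking

/-! ### Cycles, homology and homotopy equivalences -/

section Complexes

lemma d_d_apply (E : Cplx.{u}) (i j k : ℤ) (w : E.X i) :
    (E.d j k).hom ((E.d i j).hom w) = 0 := by
  rw [← ModuleCat.comp_apply, E.d_comp_d]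
  rfl

lemma exists_boundary_of_isSTorsion {E : Cplx.{u}} {i j k : ℤ} (hij : j + 1 = i) (hjk : k + 1 = j)
    (h : IsSTorsion (E.homology j)) :
    ∃ p ∈ alexanderPolynomials, ∀ y, (E.d j k).hom y = 0 → ∃ w, (E.d i j).hom w = p • y := by
  obtain ⟨p, hp, hpE⟩ := h
  refine ⟨p, hp, fun y hy => ?_⟩
  have hi : (ComplexShape.down ℤ).prev j = i := by rw [ChainComplex.prev, hij]
  have hk : (ComplexShape.down ℤ).next j = k := by
    rw [ChainComplex.next, ← hjk, add_sub_cancel_right]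
  let S := E.sc' i j k
  let e : E.homology j ≃ₗ[GroupRing] LinearMap.ker S.g.hom ⧸ LinearMap.range S.moduleCatToCycles :=
    (E.homologyIsoSc' i j k hi hk ≪≫ S.moduleCatHomologyIso).toLinearEquiv
  let y' : LinearMap.ker S.g.hom := ⟨y, hy⟩
  have h1 : p • (LinearMap.range S.moduleCatToCycles).mkQ y' = 0 := by
    have := congrArg e (hpE (e.symm ((LinearMap.range S.moduleCatToCycles).mkQ y')))
    rwa [map_smul, map_zero, e.apply_symm_apply] at this
  rw [← map_smul, Submodule.mkQ_apply, Submodule.Quotient.mk_eq_zero] at h1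
  obtain ⟨w, hw⟩ := h1
  exact ⟨w, congrArg Subtype.val hw⟩

lemma homotopy_apply {A B : Cplx.{u}} {g h : A ⟶ B} (H : Homotopy g h) {i j k : ℤ}
    (hij : j + 1 = i) (hjk : k + 1 = j) (y : A.X j) (hy : (A.d j k).hom y = 0) :
    (g.f j).hom y = (B.d i j).hom ((H.hom j i).hom y) + (h.f j).hom y := by
  have h1 := H.comm j
  rw [dNext_eq H.hom (show (ComplexShape.down ℤ).Rel j k from hjk),
    prevD_eq H.hom (show (ComplexShape.down ℤ).Rel i j from hij)] at h1
  rw [h1]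
  simp [hy]

lemma homotopyEquiv_surjective {A B : Cplx.{u}} (e : HomotopyEquiv A B) {i j k : ℤ}
    (hij : j + 1 = i) (hjk : k + 1 = j) (c : B.X j) (hc : (B.d j k).hom c = 0) :
    ∃ y : A.X j, (A.d j k).hom y = 0 ∧
      ∃ v : B.X i, (e.hom.f j).hom y = (B.d i j).hom v + c := by
  refine ⟨(e.inv.f j).hom c, ?_, _, homotopy_apply e.homotopyInvHomId hij hjk c hc⟩
  rw [← ModuleCat.comp_apply, e.inv.comm, ModuleCat.comp_apply, hc, map_zero]

lemma homotopyEquiv_injective {A B : Cplx.{u}} (e : HomotopyEquiv A B) {i j k : ℤ}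
    (hij : j + 1 = i) (hjk : k + 1 = j) (y : A.X j) (hy : (A.d j k).hom y = 0) (w : B.X i)
    (hw : (e.hom.f j).hom y = (B.d i j).hom w) : ∃ v : A.X i, (A.d i j).hom v = y := by
  have h := homotopy_apply e.homotopyHomInvId hij hjk y hy
  have h1 : ((e.hom ≫ e.inv).f j).hom y = (A.d i j).hom ((e.inv.f i).hom w) := by
    rw [HomologicalComplex.comp_f, ModuleCat.comp_apply, hw, ← ModuleCat.comp_apply,
      ← ModuleCat.comp_apply, e.inv.comm]
  refine ⟨(e.inv.f i).hom w - (e.homotopyHomInvId.hom j i).hom y, ?_⟩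
  rw [map_sub, ← h1, h]
  simp

lemma mem_cocycles_apply {E : Cplx.{u}} {k : ℤ} (x : cocycles E k) (w : E.X (k + 1)) :
    (x : ConjDual (E.X k)) ((E.d (k + 1) k).hom w) = 0 :=
  DFunLike.congr_fun (LinearMap.mem_ker.1 x.2) w

lemma conj_intCast (n : ℤ) : conj (n : GroupRing) = n := map_intCast conj n

/-- The kernel of the passage to `F H^k` consists of the cocycles that are coboundaries up to a
nonzero integer. -/
lemma classOf_eq_zero_iff {E : Cplx.{u}} {k : ℤ} (x : cocycles E k) :
    classOf E k x = 0 ↔ ∃ n : ℤ, n ≠ 0 ∧ ∃ z, codiff E (k - 1) k z = (n : GroupRing) • x.1 := by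
  have key : ∀ n : ℤ, n • (coboundaries E k).mkQ x = 0 ↔
      ∃ z, codiff E (k - 1) k z = (n : GroupRing) • x.1 := fun n => by
    rw [← Int.cast_smul_eq_zsmul GroupRing, ← map_smul, Submodule.mkQ_apply,
      Submodule.Quotient.mk_eq_zero]
    rfl
  rw [classOf, LinearMap.comp_apply, Submodule.mkQ_apply, Submodule.Quotient.mk_eq_zero,
    Submodule.mem_torsion'_iff]
  constructor
  · rintro ⟨n, hn⟩
    exact ⟨n, nonZeroDivisors.ne_zero n.2, (key n).1 hn⟩
  · rintro ⟨n, hn, hz⟩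
    exact ⟨⟨n, mem_nonZeroDivisors_of_ne_zero hn⟩, (key n).2 hz⟩

lemma classOf_surjective (E : Cplx.{u}) (k : ℤ) : Function.Surjective (classOf E k) :=
  (Submodule.mkQ_surjective _).comp (Submodule.mkQ_surjective _)

end Complexes

/-! ### Poincaré duality -/

section Duality

variable {C D : Cplx.{u}} [∀ r, Module.Finite GroupRing (C.X r)]
  [∀ r, Module.Projective GroupRing (C.X r)] [∀ r, Module.Finite GroupRing (D.X r)]
  [∀ r, Module.Projective GroupRing (D.X r)] {f : C ⟶ D} {n : ℕ} (Q : SymmetricPair f n)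
  {k i j l : ℤ}

lemma d_dualityMap_eq_zero (hkj : k + j = n + 1) (hjl : l + 1 = j) (y : cocycles (cone f) k) :
    (D.d j l).hom (dualityMap Q k j y) = 0 := by
  subst hjl
  rw [d_dualityMap Q k l (by lia), LinearMap.mem_ker.1 y.2, map_zero, smul_zero]

lemma dualityMap_codiff (hkj : k + j = n + 1) (hij : j + 1 = i)
    (x : ConjDual ((cone f).X (k - 1))) :
    ∃ w : D.X i, (D.d i j).hom w = dualityMap Q k j (codiff (cone f) (k - 1) k x) := by
  obtain ⟨k', rfl⟩ : ∃ k', k = k' + 1 := ⟨k - 1, by lia⟩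
  obtain ⟨k'', hk''⟩ : ∃ k'', k'' = k' + 1 - 1 := ⟨_, rfl⟩
  revert x
  rw [← hk'']
  intro x
  obtain rfl : k'' = k' := by lia
  subst hij
  refine ⟨(j + 1).negOnePow • dualityMap Q k'' (j + 1) x, ?_⟩
  rw [negOnePow_smul_eq, map_smul, ← negOnePow_smul_eq, d_dualityMap Q k'' j (by lia), smul_smul,
    ← Int.negOnePow_add, Int.negOnePow_even _ ⟨_, rfl⟩, one_smul]

variable {Q} (hQ : Q.IsPoincare)
include hQ

/-- Every cycle of `D` is homologous to the dual of a cocycle of the cone. -/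
lemma exists_dualityMap_eq (hkj : k + j = n + 1) (hij : j + 1 = i) (hjl : l + 1 = j) (c : D.X j)
    (hc : (D.d j l).hom c = 0) :
    ∃ (y : cocycles (cone f) k) (v : D.X i), dualityMap Q k j y = (D.d i j).hom v + c := by
  obtain ⟨e, he⟩ := hQ
  obtain ⟨y, hy, v, hv⟩ := homotopyEquiv_surjective e hij hjl c hc
  rw [he] at hv
  obtain rfl : k = n + 1 - j := by lia
  refine ⟨⟨y, ?_⟩, v, hv⟩
  have h : ∀ k', k' = (n : ℤ) + 1 - l → codiff (cone f) (n + 1 - j) k' y = 0 := by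
    rintro _ rfl
    have h1 : j.negOnePow • codiff (cone f) (n + 1 - j) (n + 1 - l) y = 0 := hy
    rwa [smul_eq_zero_iff_eq] at h1
  exact h _ (by lia)

/-- A cocycle of the cone whose dual is a boundary is a coboundary. -/
lemma exists_codiff_eq (hkj : k + j = n + 1) (hij : j + 1 = i) (y : cocycles (cone f) k) (w : D.X i)
    (hw : (D.d i j).hom w = dualityMap Q k j y) :
    ∃ x, codiff (cone f) (k - 1) k x = y := by
  obtain ⟨e, he⟩ := hQ
  obtain rfl : k = n + 1 - j := by lia
  have hy : ∀ k', k' = (n : ℤ) + 1 - j + 1 → codiff (cone f) (n + 1 - j) k' y = 0 := by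
    rintro _ rfl
    exact y.2
  have hy' : ((dualComplex (cone f) (n + 1)).d j (j - 1)).hom y.1 = 0 := by
    change j.negOnePow • codiff (cone f) (n + 1 - j) (n + 1 - (j - 1)) y = 0
    rw [hy _ (by lia), smul_zero]
  obtain ⟨v, hv⟩ := homotopyEquiv_injective e hij (by lia) y.1 hy' w (by rw [he]; exact hw.symm)
  have hv' : ∀ k', k' = (n : ℤ) + 1 - i → ∃ x, codiff (cone f) k' (n + 1 - j) x = y := by
    rintro _ rfl
    obtain ⟨v', hv'⟩ : ∃ v' : ConjDual ((cone f).X (n + 1 - i)), v' = v := ⟨v, rfl⟩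
    have h : i.negOnePow • codiff (cone f) (n + 1 - i) (n + 1 - j) v' = y.1 := by
      rw [hv']
      exact hv
    refine ⟨i.negOnePow • v', ?_⟩
    rw [← h, negOnePow_smul_eq, negOnePow_smul_eq, map_smul]
  exact hv' _ (by lia)

end Duality

/-! ### Descent of pairings -/

/-- A sesquilinear pairing whose left and right kernels are those of `πA` and `πB`, and which
represents every functional that factors through these maps, descends to a nonsingular pairing. -/
lemma exists_nonsingular_of_kernels {X Y : Type*} {A B : Type u} [AddCommGroup X]
    [Module GroupRing X] [AddCommGroup Y] [Module GroupRing Y] [AddCommGroup A]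
    [Module GroupRing A] [AddCommGroup B] [Module GroupRing B]
    (β : X →ₛₗ[conj] Y →ₗ[GroupRing] FracMod) (πA : X →ₗ[GroupRing] A) (πB : Y →ₗ[GroupRing] B)
    (hπA : Function.Surjective πA) (hπB : Function.Surjective πB)
    (hA : ∀ x, πA x = 0 ↔ ∀ y, β x y = 0) (hB : ∀ y, πB y = 0 ↔ ∀ x, β x y = 0)
    (hsA : ∀ h : Y →ₗ[GroupRing] FracMod, (∀ y, πB y = 0 → h y = 0) → ∃ x, ∀ y, β x y = h y)
    (hsB : ∀ g : X →ₛₗ[conj] FracMod, (∀ x, πA x = 0 → g x = 0) → ∃ y, ∀ x, β x y = g x) :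
    ∃ Bl : A →ₛₗ[conj] B →ₗ[GroupRing] FracMod, IsNonsingular Bl ∧
      ∀ x y, Bl (πA x) (πB y) = β x y := by
  have key : ∀ x x' y y', πA x = πA x' → πB y = πB y' → β x y = β x' y' := by
    intro x x' y y' hx hy
    have h1 := (hA (x - x')).1 (by rw [map_sub, hx, sub_self]) y
    have h2 := (hB (y - y')).1 (by rw [map_sub, hy, sub_self]) x'
    rw [map_sub, LinearMap.sub_apply, sub_eq_zero] at h1
    rw [map_sub, sub_eq_zero] at h2
    exact h1.trans h2
  have hsA' := Function.surjInv_eq hπA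
  have hsB' := Function.surjInv_eq hπB
  let Bl : A →ₛₗ[conj] B →ₗ[GroupRing] FracMod := LinearMap.mk₂'ₛₗ conj (RingHom.id GroupRing)
    (fun a b => β (Function.surjInv hπA a) (Function.surjInv hπB b))
    (fun a a' b => by
      rw [← LinearMap.add_apply, ← map_add]
      exact key _ _ _ _ (by rw [map_add, hsA', hsA', hsA']) rfl)
    (fun c a b => by
      rw [← LinearMap.smul_apply, ← LinearMap.map_smulₛₗ]
      exact key _ _ _ _ (by rw [map_smul, hsA', hsA']) rfl)
    (fun a b b' => by
      rw [← map_add]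
      exact key _ _ _ _ rfl (by rw [map_add, hsB', hsB', hsB']))
    (fun c a b => by
      rw [RingHom.id_apply, ← map_smul]
      exact key _ _ _ _ rfl (by rw [map_smul, hsB', hsB']))
  have hBl : ∀ x y, Bl (πA x) (πB y) = β x y := fun x y => key _ _ _ _ (hsA' _) (hsB' _)
  refine ⟨Bl, ⟨⟨?_, fun h => ?_⟩, ⟨?_, fun g => ?_⟩⟩, hBl⟩
  · rw [injective_iff_map_eq_zero]
    intro a ha
    obtain ⟨x, rfl⟩ := hπA a
    exact (hA x).2 fun y => by rw [← hBl, ha, LinearMap.zero_apply]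
  · obtain ⟨x, hx⟩ := hsA (h ∘ₗ πB) fun y hy => by rw [LinearMap.comp_apply, hy, map_zero]
    refine ⟨πA x, LinearMap.ext fun b => ?_⟩
    obtain ⟨y, rfl⟩ := hπB b
    rw [hBl, hx, LinearMap.comp_apply]
  · rw [injective_iff_map_eq_zero]
    intro b hb
    obtain ⟨y, rfl⟩ := hπB b
    exact (hB y).2 fun x => by rw [← hBl, ← LinearMap.flip_apply, hb, LinearMap.zero_apply]
  · obtain ⟨y, hy⟩ := hsB (g.comp πA) fun x hx => by rw [LinearMap.comp_apply, hx, map_zero]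
    refine ⟨πB y, LinearMap.ext fun a => ?_⟩
    obtain ⟨x, rfl⟩ := hπA a
    rw [LinearMap.flip_apply, hBl, hy, LinearMap.comp_apply]

/-! ### The Blanchfield pairing -/

section Pairing

lemma ofDual_mem_cocycles_iff {D : Cplx.{u}} {i : ℤ} {x : Module.Dual GroupRing (D.X i)} :
    ConjDual.ofDual x ∈ cocycles D i ↔ (D.d (i + 1) i).hom.dualMap x = 0 := by
  rw [LinearMap.mem_ker]
  exact ⟨fun h => LinearMap.ext fun v => DFunLike.congr_fun h v,
    fun h => ConjDual.ext fun v => LinearMap.congr_fun h v⟩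

/-- A conjugate-linear map on the cocycles is linear for the pointwise module structure. -/
lemma exists_pointwise_linear {D : Cplx.{u}} {i : ℤ} (g : cocycles D i →ₛₗ[conj] FracMod) :
    ∃ g' : LinearMap.ker (D.d (i + 1) i).hom.dualMap →ₗ[GroupRing] FracMod,
      ∀ x, g' x = g ⟨ConjDual.ofDual x.1, ofDual_mem_cocycles_iff.2 x.2⟩ := by
  refine ⟨{ toFun x := g ⟨ConjDual.ofDual x.1, ofDual_mem_cocycles_iff.2 x.2⟩
            map_add' x x' := ?_
            map_smul' a x := ?_ }, fun x => rfl⟩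
  · rw [← map_add]
    rfl
  · rw [RingHom.id_apply]
    conv_rhs => rw [← conj_conj a, ← LinearMap.map_smulₛₗ]
    refine congrArg g (Subtype.ext (ConjDual.ext fun w => ?_))
    change a * x.1 w = conj (conj a) * x.1 w
    rw [conj_conj]

/-- A cocycle vanishes on all cycles, since these are boundaries up to a nonzero scalar. -/
lemma cocycle_apply_eq_zero {D : Cplx.{u}} {i j : ℤ} (hS : IsSTorsion (D.homology i))
    (hij : j + 1 = i) (x : cocycles D i) (w : D.X i) (hw : (D.d i j).hom w = 0) :
    x.1.toDual w = 0 := by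
  obtain ⟨q, hq, hexact⟩ := exists_boundary_of_isSTorsion rfl hij hS
  obtain ⟨v, hv⟩ := hexact w hw
  have h := mem_cocycles_apply x v
  rw [hv, map_smul, smul_eq_mul] at h
  exact (mul_eq_zero.1 h).resolve_left (ne_zero_of_mem_alexanderPolynomials hq)

lemma ofDual_mem_cocycles {D : Cplx.{u}} {i j : ℤ} {x : Module.Dual GroupRing (D.X i)}
    (hx : ∀ w, (D.d i j).hom w = 0 → x w = 0) : ConjDual.ofDual x ∈ cocycles D i :=
  LinearMap.mem_ker.2 (ConjDual.ext fun v => hx _ (d_d_apply D (i + 1) i j v))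

variable {C D : Cplx.{u}} [∀ r, Module.Finite GroupRing (C.X r)]
  [∀ r, Module.Projective GroupRing (C.X r)] [∀ r, Module.Finite GroupRing (D.X r)]
  [∀ r, Module.Projective GroupRing (D.X r)] {f : C ⟶ D} {n : ℕ} (Q : SymmetricPair f n)
  {k i j l : ℤ}

/-- The Blanchfield pairing of cocycles: the linking number of `x` with the cycle dual to `y`. -/
lemma exists_cochain_pairing (hkj : k + j = n + 1) (hij : j + 1 = i) (hjl : l + 1 = j)
    (hS : IsSTorsion (D.homology i)) {p : GroupRing} (hp : p ≠ 0)
    (hexact : ∀ y, (D.d j l).hom y = 0 → ∃ w, (D.d i j).hom w = p • y) :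
    ∃ β : cocycles D i →ₛₗ[conj] cocycles (cone f) k →ₗ[GroupRing] FracMod, ∀ x y, β x y =
      Submodule.Quotient.mk (linking (D.d i j).hom p x.1.toDual (dualityMap Q k j y)) := by
  have hx := cocycle_apply_eq_zero hS hij
  have hy := d_dualityMap_eq_zero Q hkj hjl
  refine ⟨LinearMap.mk₂'ₛₗ conj (RingHom.id GroupRing) (fun x y => Submodule.Quotient.mk
    (linking (D.d i j).hom p x.1.toDual (dualityMap Q k j y))) ?_ ?_ ?_ ?_, fun _ _ => rfl⟩
  · intro x x' y
    rw [← Submodule.Quotient.mk_add, linking, linking, linking, ← add_div, ← map_add]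
    rfl
  · intro c x y
    rw [← Submodule.Quotient.mk_smul, linking, linking, Algebra.smul_def, ← mul_div_assoc,
      ← map_mul]
    rfl
  · intro x y y'
    rw [← Submodule.Quotient.mk_add, ← linking_add_right hp hexact (hx x) (hy y) (hy y'), ← map_add]
    rfl
  · intro c x y
    rw [RingHom.id_apply, ← Submodule.Quotient.mk_smul,
      ← linking_smul_right hp hexact (hx x) c (hy y), ← map_smul]
    rfl

section Kernels

variable (hQ : Q.IsPoincare) (hkj : k + j = n + 1) (hij : j + 1 = i) (hjl : l + 1 = j)
  (hS : IsSTorsion (D.homology i)) {p : GroupRing} (hp : p ∈ alexanderPolynomials)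
  (hexact : ∀ y, (D.d j l).hom y = 0 → ∃ w, (D.d i j).hom w = p • y)
include hQ hkj hij hjl hp hexact

/-- Every functional on the cohomology of the cone is linking with a cocycle of `D`. -/
lemma exists_left_linking_eq (h : cocycles (cone f) k →ₗ[GroupRing] FracMod)
    (hh : ∀ y, classOf (cone f) k y = 0 → h y = 0) : ∃ x : cocycles D i,
      ∀ y : cocycles (cone f) k,
      Submodule.Quotient.mk (linking (D.d i j).hom p x.1.toDual (dualityMap Q k j y)) = h y := by
  have hp0 := ne_zero_of_mem_alexanderPolynomials hp
  -- By duality, a functional on the cocycles of the cone gives one on the cycles of `D`.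
  have hex : ∀ c : LinearMap.ker (D.d j l).hom, ∃ (y : cocycles (cone f) k) (v : D.X i),
      dualityMap Q k j y = (D.d i j).hom v + c := fun c =>
    exists_dualityMap_eq hQ hkj hij hjl c.1 c.2
  choose y v hyv using hex
  have huniq : ∀ (c : LinearMap.ker (D.d j l).hom) (y' : cocycles (cone f) k) (v' : D.X i),
      dualityMap Q k j y' = (D.d i j).hom v' + c → h y' = h (y c) := by
    intro c y' v' hy'
    rw [← sub_eq_zero, ← map_sub]
    refine hh _ ((classOf_eq_zero_iff _).2 ⟨1, one_ne_zero, ?_⟩)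
    rw [Int.cast_one, one_smul]
    refine exists_codiff_eq hQ hkj hij _ (v' - v c) ?_
    rw [Submodule.coe_sub, map_sub, map_sub, hy', hyv, add_sub_add_right_eq_sub]
  let h' : LinearMap.ker (D.d j l).hom →ₗ[GroupRing] FracMod :=
    { toFun c := h (y c)
      map_add' c c' := by
        rw [← map_add]
        refine (huniq _ _ (v c + v c') ?_).symm
        rw [Submodule.coe_add, map_add, map_add, hyv, hyv, Submodule.coe_add, add_add_add_comm]
      map_smul' a c := by
        rw [RingHom.id_apply, ← map_smul]
        refine (huniq _ _ (a • v c) ?_).symm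
        rw [Submodule.coe_smul, map_smul, map_smul, hyv, Submodule.coe_smul, smul_add] }
  obtain ⟨x, hx0, hxh⟩ := exists_linking_eq_of_hom hp0 hexact (d_d_apply D i j l) h' fun w => by
    refine (huniq _ 0 (-w) ?_).symm.trans (map_zero h)
    rw [Submodule.coe_zero, map_zero, map_neg, neg_add_cancel]
  refine ⟨⟨ConjDual.ofDual x, ofDual_mem_cocycles hx0⟩, fun y' => ?_⟩
  refine (hxh ⟨dualityMap Q k j y', d_dualityMap_eq_zero Q hkj hjl y'⟩).trans (huniq _ _ 0 ?_).symm
  rw [map_zero, zero_add]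

include hS

lemma classOf_left_eq_zero_iff (x : cocycles D i) : classOf D i x = 0 ↔
    ∀ y : cocycles (cone f) k,
      linking (D.d i j).hom p x.1.toDual (dualityMap Q k j y) ∈ integers := by
  have hp0 := ne_zero_of_mem_alexanderPolynomials hp
  have hx := cocycle_apply_eq_zero hS hij x
  obtain rfl : j = i - 1 := by lia
  rw [classOf_eq_zero_iff]
  constructor
  · rintro ⟨a, ha, z, hz⟩ y
    refine linking_mem_of_int_primitive hp hexact hx ha (z := z.toDual) (fun w => ?_)
      (d_dualityMap_eq_zero Q hkj hjl y)
    have h := DFunLike.congr_fun hz w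
    rwa [ConjDual.smul_apply, conj_intCast] at h
  · intro h
    obtain ⟨a, z, ha, hz⟩ := exists_int_primitive_of_linking_mem hp0 hexact
      (d_d_apply D i (i - 1) l) hx fun c hc => by
        -- Duality replaces the cycle `c` by some `Φ y`, which differs from it by a boundary.
        obtain ⟨y, v, hyv⟩ := exists_dualityMap_eq hQ hkj hij hjl c hc
        have h1 := (Submodule.Quotient.mk_eq_zero integers).2 (h y)
        rw [hyv, mk_linking_boundary_add hp0 hexact hx (d_d_apply D i (i - 1) l) v hc] at h1
        exact (Submodule.Quotient.mk_eq_zero _).1 h1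
    refine ⟨a, ha, ConjDual.ofDual z, ConjDual.ext fun w => ?_⟩
    rw [ConjDual.smul_apply, conj_intCast]
    exact hz w

lemma classOf_right_eq_zero_iff (y : cocycles (cone f) k) : classOf (cone f) k y = 0 ↔
    ∀ x : cocycles D i, linking (D.d i j).hom p x.1.toDual (dualityMap Q k j y) ∈ integers := by
  have hp0 := ne_zero_of_mem_alexanderPolynomials hp
  have hy := d_dualityMap_eq_zero Q hkj hjl y
  rw [classOf_eq_zero_iff]
  constructor
  · rintro ⟨a, ha, z, hz⟩ x
    obtain ⟨w, hw⟩ := dualityMap_codiff Q hkj hij z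
    rw [hz, map_smul] at hw
    exact linking_mem_of_int_boundary hp hexact (cocycle_apply_eq_zero hS hij x) ha hy hw
  · intro h
    obtain ⟨a, w, ha, hw⟩ := exists_int_boundary_of_linking_mem hp0 hexact hy
      fun x hx => h ⟨ConjDual.ofDual x, ofDual_mem_cocycles hx⟩
    refine ⟨a, ha, exists_codiff_eq hQ hkj hij ((a : GroupRing) • y) w ?_⟩
    rw [hw, ← map_smul]
    rfl

/-- Every functional on the cohomology of `D` is linking with the dual of a cocycle of the cone. -/
lemma exists_right_linking_eq (g : cocycles D i →ₛₗ[conj] FracMod)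
    (hg : ∀ x, classOf D i x = 0 → g x = 0) : ∃ y : cocycles (cone f) k, ∀ x : cocycles D i,
      Submodule.Quotient.mk (linking (D.d i j).hom p x.1.toDual (dualityMap Q k j y)) = g x := by
  have hp0 := ne_zero_of_mem_alexanderPolynomials hp
  have hx := cocycle_apply_eq_zero hS hij
  obtain rfl : j = i - 1 := by lia
  have hd := d_d_apply D i (i - 1) l
  obtain ⟨g', hg'⟩ := exists_pointwise_linear g
  obtain ⟨c, hc, hcg⟩ := exists_linking_eq_of_dual_hom (d₃ := (D.d (i + 1) i).hom) hp0 hexact hd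
    (d_d_apply D (i + 1) i (i - 1)) (fun x hx0 => hx ⟨_, ofDual_mem_cocycles_iff.2 hx0⟩)
    g' fun z x hz => by
      rw [hg']
      refine hg _ ((classOf_eq_zero_iff _).2 ⟨1, one_ne_zero, ?_⟩)
      refine ⟨ConjDual.ofDual z, ConjDual.ext fun w => ?_⟩
      rw [Int.cast_one, one_smul]
      exact (LinearMap.congr_fun hz w).symm
  obtain ⟨y, v, hyv⟩ := exists_dualityMap_eq hQ hkj hij hjl c hc
  refine ⟨y, fun x => ?_⟩
  rw [hyv, mk_linking_boundary_add hp0 hexact (hx x) hd v hc]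
  rw [hcg ⟨x.1.toDual, ofDual_mem_cocycles_iff.1 x.2⟩, hg']
  rfl

lemma exists_nonsingular_pairing :
    ∃ Bl : FreeQuot (Cohomology D i) →ₛₗ[conj]
      FreeQuot (Cohomology (cone f) k) →ₗ[GroupRing] FracMod, IsNonsingular Bl ∧
      ∀ x y, Bl (classOf D i x) (classOf (cone f) k y) =
        Submodule.Quotient.mk (linking (D.d i j).hom p x.1.toDual (dualityMap Q k j y)) := by
  obtain ⟨β, hβ⟩ := exists_cochain_pairing Q hkj hij hjl hS
    (ne_zero_of_mem_alexanderPolynomials hp) hexact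
  have hβ0 : ∀ x y, β x y = 0 ↔
      linking (D.d i j).hom p x.1.toDual (dualityMap Q k j y) ∈ integers := fun x y => by
    rw [hβ, Submodule.Quotient.mk_eq_zero]
  obtain ⟨Bl, hBl, h⟩ := exists_nonsingular_of_kernels β (classOf D i) (classOf (cone f) k)
    (classOf_surjective D i) (classOf_surjective (cone f) k)
    (fun x => by
      simp only [hβ0]
      exact classOf_left_eq_zero_iff Q hQ hkj hij hjl hS hp hexact x)
    (fun y => by
      simp only [hβ0]
      exact classOf_right_eq_zero_iff Q hQ hkj hij hjl hS hp hexact y)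
    (fun h hh => by
      simp only [hβ]
      exact exists_left_linking_eq Q hQ hkj hij hjl hp hexact h hh)
    (fun g hg => by
      simp only [hβ]
      exact exists_right_linking_eq Q hQ hkj hij hjl hS hp hexact g hg)
  exact ⟨Bl, hBl, fun x y => by rw [h, hβ]⟩

end Kernels

end Pairing

end Blanchfield

theorem proposition5p3 {C D : Blanchfield.Cplx.{u}}
    [∀ r, Module.Finite Blanchfield.GroupRing (C.X r)]
    [∀ r, Module.Projective Blanchfield.GroupRing (C.X r)]
    [∀ r, Module.Finite Blanchfield.GroupRing (D.X r)]
    [∀ r, Module.Projective Blanchfield.GroupRing (D.X r)]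
    (f : C ⟶ D) (m : ℕ)
    (hC : Blanchfield.IsConcentrated C m) (hD : Blanchfield.IsConcentrated D (m + 1))
    (hCS : Blanchfield.IsSAcyclic C) (hDS : Blanchfield.IsSAcyclic D)
    (Q : Blanchfield.SymmetricPair f m) (hQ : Q.IsPoincare)
    (i : ℤ) (hi : 1 < i) (him : i ≤ m) :
    ∃ Bl : Blanchfield.FreeQuot (Blanchfield.Cohomology D i) →ₛₗ[Blanchfield.conj]
        Blanchfield.FreeQuot (Blanchfield.Cohomology (Blanchfield.cone f) (m - i + 2))
          →ₗ[Blanchfield.GroupRing] Blanchfield.FracMod,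
      Blanchfield.IsNonsingular Bl ∧ Blanchfield.IsBlanchfieldPairing Q i Bl := by
  have hij : i - 1 + 1 = i := by lia
  have hjl : i - 1 - 1 + 1 = i - 1 := by lia
  have hkj : (m : ℤ) - i + 2 + (i - 1) = m + 1 := by lia
  obtain ⟨p, hp, hexact⟩ := Blanchfield.exists_boundary_of_isSTorsion hij hjl (hDS (i - 1))
  obtain ⟨Bl, hBl, h⟩ := Blanchfield.exists_nonsingular_pairing Q hQ hkj hij hjl (hDS i) hp hexact
  refine ⟨Bl, hBl, fun x y c z hc hz => ?_⟩
  rw [h, Blanchfield.linking_eq_of_primitive (Blanchfield.ne_zero_of_mem_alexanderPolynomials hp)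
    hexact (Blanchfield.cocycle_apply_eq_zero (hDS i) hij x)
    (Blanchfield.d_dualityMap_eq_zero Q hkj hjl y) hc (z := z.toDual) hz]
  rfl
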